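/- **Setting.** Let $\nu=\nu_0,\nu_1,\nu_2,\dots$ be mutually singular probability measures on a measurable space $(E,\mathcal B)$, carried by pairwise disjoint measurable sets $E_0,E_1,\dots$ (that is, $\nu_n(E\setminus E_n)=0$), where $\nu$ is separable. Let $\alpha_n>0$ with $\sum_{n\ge0}\alpha_n=1$ and let $\bigcap_{n\ge 0} L^2(\nu_n)$ consist of classes of functions modulo $\sum_n\alpha_n\nu_n$-null sets. Functions are real valued; $\langle\cdot,\cdot\rangle_n$ is the inner product of $L^2(\nu_n)$ and $\langle\cdot,\cdot\rangle$ that of $L^2(\nu)$; $\mathbb N=\{1,2,\dots\}$. Put $$\mathcal D=\Big\{\varphi\in\bigcap_{n\ge0}L^2(\nu_n):\langle\varphi,\varphi\rangle_n\to\langle\varphi,\varphi\rangle\Big\},$$ and let $\mathcal F\subseteq\mathcal D$ be a linear set that is dense in $L^2(\nu)$. Let $\mathcal C$ be the set of all $\varphi\in\mathcal D$ such that for each $n\in\mathbb N$ some $\varphi_n\in\mathcal F$ satisfies $\varphi=\varphi_n$ $\nu_n$-a.e., and such that $\langle\varphi,\psi\rangle_n\to\langle\varphi,\psi\rangle$ for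 all $\psi\in\mathcal F$. Let $\mathcal V$ be the set of all $\psi\in\bigcap_{n\ge0} L^2(\nu_n)$ with $\sigma\psi\in\mathcal D$ for all $\sigma\in\mathcal D$ and $\tau\psi\in\mathcal F$ for all $\tau\in\mathcal F$. A sequence $\varphi_n\in\mathcal C$, $n\in\mathbb N$, *s-converges* to $\varphi\in L^2(\nu)$ if $\langle\varphi_n,\psi\rangle_n\to\langle\varphi,\psi\rangle$ for all $\psi\in\mathcal C$ and $\langle\varphi_n,\varphi_n\rangle_n\to\langle\varphi,\varphi\rangle$. Let $(T_{n,t})_{t\ge0}$, $n\in\mathbb N$, and $(T_t)_{t\ge0}$ be strongly continuous semigroups of bounded operators, not necessarily contractive, in $L^2(\nu_n)$ and in $L^2(\nu)$, with generators $A_n$ and $A$. Each is associated with a transition function, i.e. for every $t\ge 0$ there is a kernel $P(t,x,dy)$ with $P(t,x,E)\le1$ such that, for all $f\in L^2$, the semigroup at time $t$ maps $f$ to $\int f(y)\,P(t,\cdot,dy)$ a.e. Let $(T_{n,t}')$, $(T_t')$ be the adjoint semigroups and $A_n'$, $A'$ their generators. Assume: (i) $1\in D(A')$, $1\in D(A_n')$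 for all $n\in\mathbb N$, and $\sup_{n\in\mathbb N}\|A_n'1\|_{L^\infty(\nu_n)}<\infty$. (ii) $T_t'1\in L^\infty(\nu)$ for all $t\ge0$, and $\frac1t(T_t'1-1)\to A'1$ in $L^\infty(\nu)$ as $t\downarrow0$. (iii) Either there are measurable $N_n\subseteq E_n$, $n\in\mathbb N$, with $\nu_n(N_n)\to0$ such that for every $\varphi\in\mathcal C$ there are $\Phi_n\in\mathcal C$ with $\Phi_n=A_n'1\cdot\varphi$ $\nu_n$-a.e. on $E_n\setminus N_n$ and such that $\Phi_n$ s-converges to $A'1\cdot\varphi$; or there are $\psi_n\in\mathcal V$ with $\psi_n=A_n'1$ $\nu_n$-a.e., $n\in\mathbb N$, such that $\psi_n\varphi$ s-converges to $A'1\cdot\varphi$ for all $\varphi\in\mathcal C$. (iv) For every $n\in\mathbb N$ there is a set $D_n\subseteq D(A_n)\cap L^\infty(\nu_n)$ that is dense in $D(A_n)$ with respect to the norm $\left(\langle f,f\rangle_n+\langle A_nf,A_nf\rangle_n\right)^{1/2}$. **Lemma.** Put $$C=\tfrac12\|A'1\|_{L^\infty(\nu)}\ \vee\ \sup_{n\in\mathbb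 N}\tfrac12\|A_n'1\|_{L^\infty(\nu_n)},$$ $\hat A_nu=A_nu-\tfrac12A_n'1\cdot u$ for $u\in D(\hat A_n)=D(A_n)$, $n\in\mathbb N$, and $\hat Au=Au-\tfrac12A'1\cdot u$ for $u\in D(\hat A)=D(A)$. (a) $\hat A_n$ is the generator of a strongly continuous contraction semigroup $(\hat T_{n,t})_{t\ge0}$ in $L^2(\nu_n)$ for every $n\in\mathbb N$, and $\hat A$ is the generator of a strongly continuous contraction semigroup $(\hat T_t)_{t\ge0}$ in $L^2(\nu)$. Moreover, for all $t\ge0$, $\|\hat T_{n,t}g\|_{L^\infty(\nu_n)}\le e^{Ct}\|g\|_{L^\infty(\nu_n)}$ for $g\in L^\infty(\nu_n)$, $n\in\mathbb N$, and $\|\hat T_tg\|_{L^\infty(\nu)}\le e^{Ct}\|g\|_{L^\infty(\nu)}$ for $g\in L^\infty(\nu)$. (b) For every $\alpha\ge C$, the operator $A_n-\alpha\,\mathrm{id}$ with domain $D(A_n)$ is the generator of a strongly continuous contraction semigroup in $L^2(\nu_n)$ for every $n\in\mathbb N$, and $A-\alpha\,\mathrm{id}$ with domain $D(A)$ is the generator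 of a strongly continuous contraction semigroup in $L^2(\nu)$. -/

import Mathlib

open MeasureTheory Filter Topology
open scoped NNReal ENNReal

noncomputable section

/-! ### Operator semigroups and generators -/

section Semigroup

variable {X : Type*} [NormedAddCommGroup X] [NormedSpace ℝ X]

/-- Strongly continuous semigroups `(T_t)_{t ≥ 0}` of bounded linear operators. -/
structure IsC0Semigroup (T : ℝ≥0 → X →L[ℝ] X) : Prop where
  zero : T 0 = ContinuousLinearMap.id ℝ X
  add : ∀ s t, T (s + t) = (T s).comp (T t)
  tendsto : ∀ u, Tendsto (fun t => T t u) (𝓝[>] 0) (𝓝 u)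

/-- Strongly continuous contraction semigroups. -/
structure IsContractionSemigroup (T : ℝ≥0 → X →L[ℝ] X) : Prop extends IsC0Semigroup T where
  contraction : ∀ t u, ‖T t u‖ ≤ ‖u‖

/-- `v = lim_{t ↓ 0} (T_t u - u) / t`. -/
def HasGenLimit (T : ℝ≥0 → X →L[ℝ] X) (u v : X) : Prop :=
  Tendsto (fun t : ℝ≥0 => (t : ℝ)⁻¹ • (T t u - u)) (𝓝[>] 0) (𝓝 v)

theorem HasGenLimit.add {T : ℝ≥0 → X →L[ℝ] X} {u v u' v' : X}
    (h : HasGenLimit T u v) (h' : HasGenLimit T u' v') : HasGenLimit T (u + u') (v + v') := by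
  refine (Tendsto.add h h').congr fun t => ?_
  rw [← smul_add, map_add]
  congr 1
  abel

theorem HasGenLimit.smul {T : ℝ≥0 → X →L[ℝ] X} {u v : X} (c : ℝ)
    (h : HasGenLimit T u v) : HasGenLimit T (c • u) (c • v) := by
  refine (Tendsto.const_smul h c).congr fun t => ?_
  rw [smul_comm, smul_sub, map_smul]

theorem HasGenLimit.zero (T : ℝ≥0 → X →L[ℝ] X) : HasGenLimit T 0 0 := by
  simp [HasGenLimit]

theorem HasGenLimit.unique {T : ℝ≥0 → X →L[ℝ] X} {u v v' : X}
    (h : HasGenLimit T u v) (h' : HasGenLimit T u v') : v = v' :=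
  tendsto_nhds_unique h h'

/-- The (infinitesimal) generator of `(T_t)_{t ≥ 0}`, as an unbounded operator: its domain consists
of all `u` for which `lim_{t ↓ 0} (T_t u - u) / t` exists, and its value at `u` is this limit. -/
def generator (T : ℝ≥0 → X →L[ℝ] X) : X →ₗ.[ℝ] X where
  domain :=
    { carrier := {u | ∃ v, HasGenLimit T u v}
      add_mem' := fun ⟨_, h⟩ ⟨_, h'⟩ => ⟨_, h.add h'⟩
      zero_mem' := ⟨0, HasGenLimit.zero T⟩
      smul_mem' := fun c _ ⟨_, h⟩ => ⟨_, h.smul c⟩ }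
  toFun :=
    { toFun := fun u => u.2.choose
      map_add' := fun u u' =>
        (u + u').2.choose_spec.unique (u.2.choose_spec.add u'.2.choose_spec)
      map_smul' := fun c u => (c • u).2.choose_spec.unique (u.2.choose_spec.smul c) }

/-- The unbounded operator `A - B` with domain `D(A)`, for a bounded operator `B`. -/
def LinearPMap.subBounded (A : X →ₗ.[ℝ] X) (B : X →L[ℝ] X) : X →ₗ.[ℝ] X where
  domain := A.domain
  toFun := A.toFun - B.toLinearMap.comp A.domain.subtype

end Semigroup

/-! ### Operators on a single `L²` space -/

section LTwo

variable {E : Type*} [MeasurableSpace E]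

/-- The semigroup `(T_t')_{t ≥ 0}` of Hilbert space adjoints. -/
def dualSemigroup {μ : Measure E} (T : ℝ≥0 → Lp ℝ 2 μ →L[ℝ] Lp ℝ 2 μ) :
    ℝ≥0 → Lp ℝ 2 μ →L[ℝ] Lp ℝ 2 μ :=
  fun t => ContinuousLinearMap.adjoint (T t)

/-- The operator `A'`: the generator of the dual semigroup. -/
def dualGenerator {μ : Measure E} (T : ℝ≥0 → Lp ℝ 2 μ →L[ℝ] Lp ℝ 2 μ) :
    Lp ℝ 2 μ →ₗ.[ℝ] Lp ℝ 2 μ :=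
  generator (dualSemigroup T)

/-- The element `A' 1` of `L²`, where `1` belongs to the domain of `A'`. -/
def dualOne {μ : Measure E} [IsFiniteMeasure μ] (T : ℝ≥0 → Lp ℝ 2 μ →L[ℝ] Lp ℝ 2 μ)
    (h : Lp.const 2 μ (1 : ℝ) ∈ (dualGenerator T).domain) : Lp ℝ 2 μ :=
  dualGenerator T ⟨Lp.const 2 μ (1 : ℝ), h⟩

/-- The bounded operator `u ↦ a · u` on `L²`, for `a ∈ L^∞`. -/
def mulBounded {μ : Measure E} (a : E → ℝ) (ha : MemLp a ∞ μ) : Lp ℝ 2 μ →L[ℝ] Lp ℝ 2 μ :=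
  (ContinuousLinearMap.mul ℝ ℝ).holderL μ ∞ 2 2 (ha.toLp a)

/-- `(T_t)` is associated with a transition function `P(t, x, B)`:
`T_t f = ∫ f(y) P(t, ·, dy)` almost everywhere, for all `t ≥ 0` and `f ∈ L²`.
Total masses `P(t, x, E) ≤ 1` are allowed, which includes transition probability functions. -/
def HasTransitionFunction {μ : Measure E} (T : ℝ≥0 → Lp ℝ 2 μ →L[ℝ] Lp ℝ 2 μ) : Prop :=
  ∃ P : ℝ≥0 → ProbabilityTheory.Kernel E E, (∀ t x, P t x Set.univ ≤ 1) ∧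
    ∀ (t : ℝ≥0) (f : E → ℝ), Measurable f → ∀ hf : MemLp f 2 μ,
      ∀ᵐ x ∂μ, Integrable f (P t x) ∧ T t (hf.toLp f) x = ∫ y, f y ∂(P t x)

end LTwo

/-! ### Sequences of `L²` spaces -/

/-- A sequence `ν_0, ν_1, ν_2, …` of mutually singular probability measures on `E`, carried by
disjoint sets `E_n`, where `ν = ν_0` (the limit measure) is separable, with positive weights `α_n`
that sum to one. -/
structure MeasureSequence (E : Type*) [MeasurableSpace E] where
  /-- `meas 0` is the limit measure `ν`, and `meas n` is `ν_n` for `n ≥ 1`. -/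
  meas : ℕ → Measure E
  isProbabilityMeasure : ∀ n, IsProbabilityMeasure (meas n)
  mutuallySingular : Pairwise fun m n => (meas m).MutuallySingular (meas n)
  isSeparable : IsSeparable (meas 0)
  /-- The sets `E_n`. -/
  space : ℕ → Set E
  measurableSet_space : ∀ n, MeasurableSet (space n)
  disjoint_space : Pairwise fun m n => Disjoint (space m) (space n)
  meas_compl_space : ∀ n, meas n (space n)ᶜ = 0
  weight : ℕ → ℝ
  weight_pos : ∀ n, 0 < weight n
  hasSum_weight : HasSum weight 1

namespace MeasureSequence

variable {E : Type*} [MeasurableSpace E] (M : MeasureSequence E)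

instance (n : ℕ) : IsProbabilityMeasure (M.meas n) := M.isProbabilityMeasure n

/-- The measure `∑ α_n ν_n`. -/
def total : Measure E := Measure.sum fun n => ENNReal.ofReal (M.weight n) • M.meas n

/-- `⟨f, g⟩_n = ∫ f g dν_n`. -/
def ip (n : ℕ) (f g : E → ℝ) : ℝ := ∫ x, f x * g x ∂(M.meas n)

/-- `⋂ₙ L²(E, ν_n)`, whose elements are classes of functions modulo `∑ α_n ν_n`-null sets. -/
def interL2 : Set (E →ₘ[M.total] ℝ) := {φ | ∀ n, MemLp φ 2 (M.meas n)}

/-- The set `𝒟` of all `φ ∈ ⋂ₙ L²(E, ν_n)` with `⟨φ, φ⟩_n → ⟨φ, φ⟩`. -/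
def setD : Set (E →ₘ[M.total] ℝ) :=
  {φ | φ ∈ M.interL2 ∧ Tendsto (fun n => M.ip n φ φ) atTop (𝓝 (M.ip 0 φ φ))}

end MeasureSequence

/-- A linear subset `ℱ` of `𝒟` that is dense in `L²(E, ν)`. -/
structure TestSpace {E : Type*} [MeasurableSpace E] (M : MeasureSequence E) where
  space : Submodule ℝ (E →ₘ[M.total] ℝ)
  subset_setD : (space : Set (E →ₘ[M.total] ℝ)) ⊆ M.setD
  dense : Dense {f : Lp ℝ 2 (M.meas 0) | ∃ φ ∈ space, f =ᵐ[M.meas 0] φ}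

namespace TestSpace

variable {E : Type*} [MeasurableSpace E] {M : MeasureSequence E} (F : TestSpace M)

/-- The set `𝒞`: all `φ ∈ 𝒟` such that for every `n ≥ 1` some element of `ℱ` equals `φ`
`ν_n`-almost everywhere, and `⟨φ, ψ⟩_n → ⟨φ, ψ⟩` for all `ψ ∈ ℱ`. -/
def setC : Set (E →ₘ[M.total] ℝ) :=
  {φ | φ ∈ M.setD ∧
    (∃ φ' : ℕ → (E →ₘ[M.total] ℝ), ∀ n, 1 ≤ n → φ' n ∈ F.space ∧ φ =ᵐ[M.meas n] φ' n) ∧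
    ∀ ψ ∈ F.space, Tendsto (fun n => M.ip n φ ψ) atTop (𝓝 (M.ip 0 φ ψ))}

/-- The set `𝒱` of all `ψ ∈ ⋂ₙ L²(E, ν_n)` with `σψ ∈ 𝒟` for `σ ∈ 𝒟` and `τψ ∈ ℱ` for `τ ∈ ℱ`. -/
def setV : Set (E →ₘ[M.total] ℝ) :=
  {ψ | ψ ∈ M.interL2 ∧ (∀ σ ∈ M.setD, σ * ψ ∈ M.setD) ∧ ∀ τ ∈ F.space, τ * ψ ∈ F.space}

/-- `w`-convergence of a sequence `φ_n ∈ 𝒞`, `n ≥ 1`, to `f ∈ L²(E, ν)`. -/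
def WConv (φ : ℕ → (E →ₘ[M.total] ℝ)) (f : E → ℝ) : Prop :=
  (∀ n, 1 ≤ n → φ n ∈ F.setC) ∧ MemLp f 2 (M.meas 0) ∧
    ∀ ψ ∈ F.setC, Tendsto (fun n => M.ip n (φ n) ψ) atTop (𝓝 (M.ip 0 f ψ))

/-- `s`-convergence of a sequence `φ_n ∈ 𝒞`, `n ≥ 1`, to `f ∈ L²(E, ν)`. -/
def SConv (φ : ℕ → (E →ₘ[M.total] ℝ)) (f : E → ℝ) : Prop :=
  F.WConv φ f ∧ Tendsto (fun n => M.ip n (φ n) (φ n)) atTop (𝓝 (M.ip 0 f f))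

end TestSpace

/-- Families of semigroups `(T_{n,t})_{t ≥ 0}` in `L²(E, ν_n)`, `n ≥ 1`, and `(T_t)_{t ≥ 0}` in
`L²(E, ν)` (index `0`): strongly continuous, not necessarily contractive, and associated with
transition functions. -/
structure IsAdmissibleFamily {E : Type*} [MeasurableSpace E] (M : MeasureSequence E)
    (T : ∀ n, ℝ≥0 → Lp ℝ 2 (M.meas n) →L[ℝ] Lp ℝ 2 (M.meas n)) : Prop where
  isC0Semigroup : ∀ n, IsC0Semigroup (T n)
  hasTransitionFunction : ∀ n, HasTransitionFunction (T n)

/-- The standing condition on `A' 1`, `A_n' 1` and the domains `D(A_n)`. Index `0` stands for the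
limit objects `ν`, `T`, `A'`. -/
structure DualUnitCondition {E : Type*} [MeasurableSpace E] {M : MeasureSequence E} (F : TestSpace M)
    (T : ∀ n, ℝ≥0 → Lp ℝ 2 (M.meas n) →L[ℝ] Lp ℝ 2 (M.meas n)) : Prop where
  /-- `1 ∈ D(A')` and `1 ∈ D(A_n')`. -/
  one_mem : ∀ n, Lp.const 2 (M.meas n) (1 : ℝ) ∈ (dualGenerator (T n)).domain
  /-- `sup_{n ≥ 1} ‖A_n' 1‖_∞ < ∞`. -/
  iSup_lt_top : ⨆ (n : ℕ) (_ : 1 ≤ n), eLpNorm (dualOne (T n) (one_mem n)) ∞ (M.meas n) < ∞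
  /-- `T_t' 1 ∈ L^∞`. -/
  memLp_dualSemigroup_one : ∀ t,
    MemLp (dualSemigroup (T 0) t (Lp.const 2 (M.meas 0) (1 : ℝ))) ∞ (M.meas 0)
  /-- `A' 1 = lim_{t ↓ 0} (T_t' 1 - 1) / t` in `L^∞`. -/
  tendsto_top : Tendsto (fun t : ℝ≥0 => eLpNorm
      ((t : ℝ)⁻¹ • (dualSemigroup (T 0) t (Lp.const 2 (M.meas 0) (1 : ℝ))
          - Lp.const 2 (M.meas 0) (1 : ℝ)) - dualOne (T 0) (one_mem 0) : Lp ℝ 2 (M.meas 0))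
      ∞ (M.meas 0)) (𝓝[>] 0) (𝓝 0)
  /-- Approximation of `A' 1 · φ` by `A_n' 1 · φ`, `φ ∈ 𝒞`, in one of two alternative senses. -/
  approx :
    (∃ N : ℕ → Set E, (∀ n, 1 ≤ n → MeasurableSet (N n) ∧ N n ⊆ M.space n) ∧
      Tendsto (fun n => M.meas n (N n)) atTop (𝓝 0) ∧
      ∀ φ ∈ F.setC, ∃ Φ : ℕ → (E →ₘ[M.total] ℝ),
        (∀ n, 1 ≤ n → Φ n ∈ F.setC ∧
          ∀ᵐ x ∂(M.meas n), x ∈ M.space n \ N n → Φ n x = dualOne (T n) (one_mem n) x * φ x) ∧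
        F.SConv Φ (fun x => dualOne (T 0) (one_mem 0) x * φ x)) ∨
    (∃ ψ : ℕ → (E →ₘ[M.total] ℝ),
      (∀ n, 1 ≤ n → ψ n ∈ F.setV ∧ ψ n =ᵐ[M.meas n] dualOne (T n) (one_mem n)) ∧
      ∀ φ ∈ F.setC, F.SConv (fun n => ψ n * φ) (fun x => dualOne (T 0) (one_mem 0) x * φ x))
  /-- A set `D_n ⊆ D(A_n) ∩ L^∞` is dense in `D(A_n)` for the graph norm of `A_n`. -/
  core : ∀ n, 1 ≤ n → ∃ D : Set (generator (T n)).domain,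
    (∀ f ∈ D, MemLp (f : Lp ℝ 2 (M.meas n)) ∞ (M.meas n)) ∧
    ∀ (u : (generator (T n)).domain) (ε : ℝ), 0 < ε → ∃ f ∈ D,
      √(‖((f - u : (generator (T n)).domain) : Lp ℝ 2 (M.meas n))‖ ^ 2
        + ‖generator (T n) (f - u)‖ ^ 2) < ε

namespace DualUnitCondition

variable {E : Type*} [MeasurableSpace E] {M : MeasureSequence E} {F : TestSpace M}
  {T : ∀ n, ℝ≥0 → Lp ℝ 2 (M.meas n) →L[ℝ] Lp ℝ 2 (M.meas n)}

/-- The function `A_n' 1` for `n ≥ 1`, and `A' 1` for `n = 0`. -/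
def dualOneAt (h : DualUnitCondition F T) (n : ℕ) : Lp ℝ 2 (M.meas n) := dualOne (T n) (h.one_mem n)

theorem memLp_top (h : DualUnitCondition F T) (n : ℕ) : MemLp (h.dualOneAt n) ∞ (M.meas n) := by
  rcases Nat.eq_zero_or_pos n with rfl | hn
  · obtain ⟨t, ht⟩ := (h.tendsto_top.eventually (gt_mem_nhds ENNReal.zero_lt_top)).exists
    have h1 : MemLp ((t : ℝ)⁻¹ • (dualSemigroup (T 0) t (Lp.const 2 (M.meas 0) (1 : ℝ))
        - Lp.const 2 (M.meas 0) (1 : ℝ)) - dualOne (T 0) (h.one_mem 0) : Lp ℝ 2 (M.meas 0))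
        ∞ (M.meas 0) := ⟨Lp.aestronglyMeasurable _, ht⟩
    have h2 : MemLp ((t : ℝ)⁻¹ • (dualSemigroup (T 0) t (Lp.const 2 (M.meas 0) (1 : ℝ))
        - Lp.const 2 (M.meas 0) (1 : ℝ)) : Lp ℝ 2 (M.meas 0)) ∞ (M.meas 0) := by
      have h3 : MemLp (Lp.const 2 (M.meas 0) (1 : ℝ)) ∞ (M.meas 0) :=
        (memLp_congr_ae (Lp.coeFn_const 2 (M.meas 0) (1 : ℝ))).2 (memLp_const (1 : ℝ))
      refine (memLp_congr_ae ((Lp.coeFn_smul _ _).trans ?_)).2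
        (((h.memLp_dualSemigroup_one t).sub h3).const_smul (t : ℝ)⁻¹)
      exact (Lp.coeFn_sub _ _).const_smul _
    refine (memLp_congr_ae ?_).2 (h2.sub h1)
    filter_upwards [Lp.coeFn_sub ((t : ℝ)⁻¹ •
      (dualSemigroup (T 0) t (Lp.const 2 (M.meas 0) (1 : ℝ)) - Lp.const 2 (M.meas 0) (1 : ℝ)))
      (dualOne (T 0) (h.one_mem 0))] with x hx
    simp only [Pi.sub_apply] at hx ⊢
    rw [hx]
    simp [dualOneAt]
  · refine ⟨Lp.aestronglyMeasurable _, lt_of_le_of_lt ?_ h.iSup_lt_top⟩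
    exact le_iSup₂ (f := fun (n : ℕ) (_ : 1 ≤ n) =>
      eLpNorm (dualOne (T n) (h.one_mem n)) ∞ (M.meas n)) n hn

/-- `C = (½ ‖A' 1‖_∞) ∨ sup_{n ≥ 1} ½ ‖A_n' 1‖_∞`, a finite number. -/
def constC (h : DualUnitCondition F T) : ℝ :=
  (eLpNorm (h.dualOneAt 0) ∞ (M.meas 0) / 2 ⊔
    ⨆ (n : ℕ) (_ : 1 ≤ n), eLpNorm (h.dualOneAt n) ∞ (M.meas n) / 2).toReal

/-- `Â_n = A_n - ½ A_n' 1 · (·)` for `n ≥ 1`, and `Â = A - ½ A' 1 · (·)` for `n = 0`,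
with the domain of `A_n`. -/
def hatA (h : DualUnitCondition F T) (n : ℕ) : Lp ℝ 2 (M.meas n) →ₗ.[ℝ] Lp ℝ 2 (M.meas n) :=
  (generator (T n)).subBounded ((1 / 2 : ℝ) • mulBounded (h.dualOneAt n) (h.memLp_top n))

end DualUnitCondition

end

/-! ### Generators, continuity of orbits and exponential rescaling. -/

noncomputable section

section SemigroupTheory

variable {X : Type*} [NormedAddCommGroup X] [NormedSpace ℝ X]

/-! Fix one index, write `a` for the dual unit `A' 1` (or `A_n' 1`) and `B` for multiplication by
`a/2`. Since the kernels have mass at most one, Cauchy–Schwarz gives `(T_t v)² ≤ T_t(v²)` almost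
everywhere for bounded `v`, hence `‖T_t v‖² ≤ ⟨T_t(v²), 1⟩`. This turns quadratic estimates in `L²`
into linear ones tested against `1`.

For `f ≥ 0` the function `t ↦ ⟨T_t f, 1⟩` has right derivative `⟨T_t f, a⟩ ≤ 2C ⟨T_t f, 1⟩`.
Gronwall and the inequality above give `‖T_t‖ ≤ e^{Ct}` (`IsC0Semigroup.norm_le_exp`), and part (b)
follows by multiplying with `e^{-αt}`.

For part (a), the semigroup `S` generated by `A - B` is the solution of the Volterra equation `S_t u
= T_t u - ∫_0^t T_{t-s} B S_s u ds` (`IsC0Semigroup.exists_perturbation`). The kernels are positive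
with mass at most one and `|a/2| ≤ C`, so Picard iteration preserves the order intervals `[-r
e^{Ct}, r e^{Ct}]`, which is the `L^∞` bound (`IsPicardLimit.ae_abs_le`).

Contractivity is an infinitesimal cancellation: for bounded `v` the upper right derivative of `‖S_t
v‖²` at `0` is at most `⟨v², a⟩ - 2⟨v, (a/2) v⟩ = 0`. As `S_t v` stays bounded, the same holds at
every later time, so the norm does not increase; density of bounded functions in `L²` finishes the
proof (`SolvesVolterra.norm_le`). -/

theorem generator_spec {T : ℝ≥0 → X →L[ℝ] X} (u : (generator T).domain) :
    HasGenLimit T u (generator T u) :=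
  u.2.choose_spec

theorem generator_apply_eq {T : ℝ≥0 → X →L[ℝ] X} (u : (generator T).domain) {v : X}
    (h : HasGenLimit T u v) : generator T u = v :=
  (generator_spec u).unique h

/-- Comparing limits of difference quotients in both directions identifies domains and values at
once, so no resolvent is needed. -/
theorem generator_eq_subBounded {S T : ℝ≥0 → X →L[ℝ] X} {B : X →L[ℝ] X}
    (h : ∀ u v, HasGenLimit S u v ↔ HasGenLimit T u (v + B u)) :
    generator S = (generator T).subBounded B := by
  have hdom : (generator S).domain = ((generator T).subBounded B).domain := by
    ext u
    constructor
    · rintro ⟨v, hv⟩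
      exact ⟨_, (h u v).1 hv⟩
    · rintro ⟨v, hv⟩
      exact ⟨v - B u, (h u _).2 (by simpa using hv)⟩
  refine LinearPMap.ext hdom fun u hu hu' => ?_
  refine generator_apply_eq ⟨u, hu⟩ ((h _ _).2 ?_)
  have hu2 : u ∈ (generator T).domain := hu'
  have key := generator_spec (T := T) ⟨u, hu2⟩
  have : ((generator T).subBounded B) ⟨u, hu'⟩ + B u = generator T ⟨u, hu2⟩ :=
    sub_add_cancel _ _
  exact this ▸ key

/-! ### Local boundedness and continuity -/

theorem IsC0Semigroup.tendsto_nhds_zero {T : ℝ≥0 → X →L[ℝ] X} (hT : IsC0Semigroup T) (u : X) :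
    Tendsto (fun t => T t u) (𝓝 0) (𝓝 u) := by
  have h1 : ContinuousWithinAt (fun t => T t u) (Set.Ioi 0) 0 := by
    have := hT.tendsto u
    simpa [ContinuousWithinAt, hT.zero] using this
  have h2 := continuousWithinAt_Ioi_iff_Ici.1 h1
  have h3 : Set.Ici (0 : ℝ≥0) = Set.univ := by ext; simp
  rw [h3, continuousWithinAt_univ] at h2
  simpa [ContinuousAt, hT.zero] using h2

/-- Otherwise there are times `t n → 0` with `‖T (t n)‖ > n`, although each orbit `T (t n) u`
converges; this contradicts the uniform boundedness principle. -/
theorem IsC0Semigroup.exists_bound_near_zero [CompleteSpace X] {T : ℝ≥0 → X →L[ℝ] X}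
    (hT : IsC0Semigroup T) : ∃ δ : ℝ≥0, 0 < δ ∧ ∃ M : ℝ, ∀ t ≤ δ, ‖T t‖ ≤ M := by
  by_contra! hcon
  have hpos : ∀ n : ℕ, (0 : ℝ≥0) < 1 / ((n : ℝ≥0) + 1) := fun n => by positivity
  choose t ht ht' using fun n : ℕ => hcon (1 / ((n : ℝ≥0) + 1)) (hpos n) n
  have ht0 : Tendsto t atTop (𝓝 0) :=
    tendsto_of_tendsto_of_tendsto_of_le_of_le tendsto_const_nhds
      (tendsto_one_div_add_atTop_nhds_zero_nat (𝕜 := ℝ≥0)) (fun _ => zero_le) ht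
  obtain ⟨C, hC⟩ := banach_steinhaus (g := fun n => T (t n)) fun u => by
    obtain ⟨C, hC⟩ := (Metric.isBounded_range_of_tendsto _
      ((hT.tendsto_nhds_zero u).comp ht0)).exists_norm_le
    exact ⟨C, fun n => hC _ ⟨n, rfl⟩⟩
  obtain ⟨n, hn⟩ := exists_nat_gt C
  exact absurd (hC n) (not_le.2 (hn.trans (ht' n)))

theorem IsC0Semigroup.exists_bound [CompleteSpace X] {T : ℝ≥0 → X →L[ℝ] X}
    (hT : IsC0Semigroup T) (b : ℝ≥0) : ∃ M : ℝ, ∀ t ≤ b, ‖T t‖ ≤ M := by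
  obtain ⟨δ, hδ, M, hM⟩ := hT.exists_bound_near_zero
  have hM0 : 0 ≤ M := (norm_nonneg _).trans (hM 0 zero_le)
  have step : ∀ n : ℕ, ∃ M' : ℝ, ∀ t ≤ n * δ, ‖T t‖ ≤ M' := by
    intro n
    induction n with
    | zero => exact ⟨M, fun t ht => hM t (by simp at ht; simp [ht])⟩
    | succ n ih =>
      obtain ⟨M', hM'⟩ := ih
      refine ⟨max M' (M * M'), fun t ht => ?_⟩
      rcases le_total t (n * δ) with h | h
      · exact (hM' t h).trans (le_max_left _ _)
      · rw [← tsub_add_cancel_of_le h, hT.add]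
        refine ((ContinuousLinearMap.opNorm_comp_le _ _).trans ?_).trans (le_max_right _ _)
        refine mul_le_mul (hM _ ?_) (hM' _ le_rfl) (norm_nonneg _) hM0
        rw [tsub_le_iff_left]
        refine ht.trans (le_of_eq ?_)
        push_cast
        ring
  obtain ⟨n, hn⟩ := exists_nat_gt (b / δ)
  obtain ⟨M', hM'⟩ := step n
  exact ⟨M', fun t ht => hM' t (ht.trans ((div_le_iff₀ hδ).1 hn.le))⟩

/-- Factoring out the operator at the smaller time treats left and right continuity together, both
reduced to continuity at time zero. -/
theorem IsC0Semigroup.norm_sub_le {T : ℝ≥0 → X →L[ℝ] X}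
    (hT : IsC0Semigroup T) {b : ℝ≥0} {M : ℝ} (hM : ∀ t ≤ b, ‖T t‖ ≤ M) (u : X) {s t : ℝ≥0}
    (hs : s ≤ b) (ht : t ≤ b) : ‖T t u - T s u‖ ≤ M * ‖T (nndist t s) u - u‖ := by
  wlog hst : s ≤ t generalizing s t
  · rw [norm_sub_rev, nndist_comm]
    exact this ht hs (le_of_not_ge hst)
  have h1 : nndist t s = t - s := by
    ext
    rw [coe_nndist, NNReal.dist_eq, NNReal.coe_sub hst,
      abs_of_nonneg (sub_nonneg.2 (NNReal.coe_le_coe.2 hst))]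
  have h2 : T t u = T s (T (t - s) u) := by
    conv_lhs => rw [← add_tsub_cancel_of_le hst, hT.add]
    rfl
  rw [h1, h2, ← map_sub]
  exact (T s).le_of_opNorm_le (hM s hs) _

theorem IsC0Semigroup.continuous [CompleteSpace X] {T : ℝ≥0 → X →L[ℝ] X}
    (hT : IsC0Semigroup T) (u : X) : Continuous fun t => T t u := by
  rw [continuous_iff_continuousAt]
  intro s
  obtain ⟨M, hM⟩ := hT.exists_bound (s + 1)
  rw [ContinuousAt, tendsto_iff_norm_sub_tendsto_zero]
  have h0 : Tendsto (fun t => M * ‖T (nndist t s) u - u‖) (𝓝 s) (𝓝 0) := by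
    have h1 : Tendsto (fun t => nndist t s) (𝓝 s) (𝓝 0) := by
      have : Continuous fun t : ℝ≥0 => nndist t s := by fun_prop
      simpa using this.tendsto s
    have h2 := tendsto_iff_norm_sub_tendsto_zero.1 ((hT.tendsto_nhds_zero u).comp h1)
    simpa using h2.const_mul M
  refine squeeze_zero' (Eventually.of_forall fun _ => norm_nonneg _) ?_ h0
  have hlt : s < s + 1 := lt_add_one s
  filter_upwards [gt_mem_nhds hlt] with t ht
  exact hT.norm_sub_le hM u hlt.le ht.le

theorem IsC0Semigroup.continuous_uncurry [CompleteSpace X] {T : ℝ≥0 → X →L[ℝ] X}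
    (hT : IsC0Semigroup T) : Continuous fun p : ℝ≥0 × X => T p.1 p.2 := by
  rw [continuous_iff_continuousAt]
  rintro ⟨s, u⟩
  obtain ⟨M, hM⟩ := hT.exists_bound (s + 1)
  rw [ContinuousAt, tendsto_iff_norm_sub_tendsto_zero]
  have h0 : Tendsto (fun p : ℝ≥0 × X => M * ‖p.2 - u‖ + ‖T p.1 u - T s u‖) (𝓝 (s, u)) (𝓝 0) := by
    have : Continuous fun p : ℝ≥0 × X => M * ‖p.2 - u‖ + ‖T p.1 u - T s u‖ := by
      have h2 : Continuous fun p : ℝ≥0 × X => T p.1 u := (hT.continuous u).comp continuous_fst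
      exact (continuous_const.mul (continuous_snd.sub continuous_const).norm).add
        (h2.sub continuous_const).norm
    simpa using this.tendsto (s, u)
  refine squeeze_zero' (Eventually.of_forall fun _ => norm_nonneg _) ?_ h0
  have hlt : s < s + 1 := lt_add_one s
  filter_upwards [continuous_fst.tendsto (s, u) |>.eventually (gt_mem_nhds hlt)] with p hp
  calc ‖T p.1 p.2 - T s u‖ = ‖T p.1 (p.2 - u) + (T p.1 u - T s u)‖ := by
        rw [map_sub]; congr 1; abel
    _ ≤ _ := (norm_add_le _ _).trans
        (add_le_add ((T p.1).le_of_opNorm_le (hM _ (le_of_lt hp)) _) le_rfl)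

/-! ### Rescaling -/

/-- The rescaled family `e^{βt} T_t`. -/
def expRescale (β : ℝ) (T : ℝ≥0 → X →L[ℝ] X) : ℝ≥0 → X →L[ℝ] X :=
  fun t => Real.exp (β * t) • T t

theorem expRescale_apply (β : ℝ) (T : ℝ≥0 → X →L[ℝ] X) (t : ℝ≥0) (u : X) :
    expRescale β T t u = Real.exp (β * t) • T t u := rfl

theorem expRescale_neg_expRescale (β : ℝ) (T : ℝ≥0 → X →L[ℝ] X) :
    expRescale (-β) (expRescale β T) = T := by
  ext t u
  rw [expRescale_apply, expRescale_apply, smul_smul, ← Real.exp_add]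
  simp

theorem tendsto_coe_nhdsGT_zero : Tendsto ((↑) : ℝ≥0 → ℝ) (𝓝[>] 0) (𝓝[>] 0) := by
  refine tendsto_nhdsWithin_iff.2 ⟨?_, ?_⟩
  · exact (NNReal.continuous_coe.tendsto 0).mono_left nhdsWithin_le_nhds
  · filter_upwards [self_mem_nhdsWithin] with t ht
    exact NNReal.coe_pos.2 ht

theorem tendsto_exp_mul_nhdsGT_zero (β : ℝ) :
    Tendsto (fun t : ℝ≥0 => Real.exp (β * t)) (𝓝[>] 0) (𝓝 1) := by
  have : Continuous fun t : ℝ≥0 => Real.exp (β * t) := by fun_prop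
  simpa using (this.tendsto 0).mono_left nhdsWithin_le_nhds

theorem IsC0Semigroup.rescale {T : ℝ≥0 → X →L[ℝ] X} (hT : IsC0Semigroup T) (β : ℝ) :
    IsC0Semigroup (expRescale β T) where
  zero := by
    ext u
    simp [expRescale_apply, hT.zero]
  add s t := by
    ext u
    simp only [expRescale_apply, hT.add, ContinuousLinearMap.comp_apply, map_smul, smul_smul,
      ← Real.exp_add, NNReal.coe_add, mul_add, add_comm]
  tendsto u := by
    simpa [expRescale_apply] using (tendsto_exp_mul_nhdsGT_zero β).smul (hT.tendsto u)

theorem tendsto_inv_mul_exp_sub_one (β : ℝ) :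
    Tendsto (fun t : ℝ≥0 => (t : ℝ)⁻¹ * (Real.exp (β * t) - 1)) (𝓝[>] 0) (𝓝 β) := by
  have h1 : HasDerivAt (fun t : ℝ => Real.exp (β * t)) β 0 := by
    simpa using ((hasDerivAt_id (0 : ℝ)).const_mul β).exp
  have h2 := (hasDerivAt_iff_tendsto_slope_zero.1 h1).mono_left
    (nhdsWithin_mono 0 fun x (hx : (0 : ℝ) < x) => hx.ne')
  refine (h2.comp tendsto_coe_nhdsGT_zero).congr fun t => ?_
  simp

theorem HasGenLimit.rescale {T : ℝ≥0 → X →L[ℝ] X} {u v : X} (h : HasGenLimit T u v) (β : ℝ) :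
    HasGenLimit (expRescale β T) u (v + β • u) := by
  have h1 := ((tendsto_exp_mul_nhdsGT_zero β).smul h).add
    ((tendsto_inv_mul_exp_sub_one β).smul_const u)
  rw [one_smul] at h1
  refine h1.congr fun t => ?_
  rw [expRescale_apply]
  module

theorem hasGenLimit_expRescale_iff {T : ℝ≥0 → X →L[ℝ] X} {u v : X} (β : ℝ) :
    HasGenLimit (expRescale β T) u v ↔ HasGenLimit T u (v - β • u) := by
  constructor
  · intro h
    have := h.rescale (-β)
    rwa [expRescale_neg_expRescale, neg_smul, ← sub_eq_add_neg] at this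
  · intro h
    simpa using h.rescale β

end SemigroupTheory

end

/-! ### Bounded perturbations through the Volterra equation. -/

noncomputable section

open scoped BoundedContinuousFunction

section Perturbation

variable {X : Type*} [NormedAddCommGroup X] [NormedSpace ℝ X]

/-! ### The Volterra operator of a semigroup -/

/-- The convolution `∫_0^t T_{t-s} g(s) ds`. -/
def volterra (T : ℝ≥0 → X →L[ℝ] X) (g : ℝ → X) (t : ℝ) : X :=
  ∫ s in (0 : ℝ)..t, T (t - s).toNNReal (g s)

variable {T : ℝ≥0 → X →L[ℝ] X}

theorem IsC0Semigroup.continuous_volterra_integrand [CompleteSpace X] (hT : IsC0Semigroup T) {g : ℝ → X}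
    (hg : Continuous g) :
    Continuous (Function.uncurry fun t s : ℝ => T (t - s).toNNReal (g s)) := by
  have h : Continuous fun p : ℝ × ℝ => ((p.1 - p.2).toNNReal, g p.2) := by fun_prop
  exact hT.continuous_uncurry.comp h

theorem IsC0Semigroup.intervalIntegrable_volterra [CompleteSpace X] (hT : IsC0Semigroup T) {g : ℝ → X}
    (hg : Continuous g) (t a b : ℝ) :
    IntervalIntegrable (fun s => T (t - s).toNNReal (g s)) volume a b :=
  Continuous.intervalIntegrable
    ((hT.continuous_volterra_integrand hg).comp (Continuous.prodMk_right t)) a b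

theorem IsC0Semigroup.continuous_volterra [CompleteSpace X] (hT : IsC0Semigroup T) {g : ℝ → X}
    (hg : Continuous g) : Continuous (volterra T g) :=
  intervalIntegral.continuous_parametric_intervalIntegral_of_continuous
    (hT.continuous_volterra_integrand hg) continuous_id

theorem IsC0Semigroup.volterra_add [CompleteSpace X] (hT : IsC0Semigroup T) {f g : ℝ → X}
    (hf : Continuous f) (hg : Continuous g) (t : ℝ) :
    volterra T (fun s => f s + g s) t = volterra T f t + volterra T g t := by
  simp only [volterra, map_add]
  exact intervalIntegral.integral_add (hT.intervalIntegrable_volterra hf t 0 t)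
    (hT.intervalIntegrable_volterra hg t 0 t)

theorem volterra_smul (c : ℝ) (g : ℝ → X) (t : ℝ) :
    volterra T (fun s => c • g s) t = c • volterra T g t := by
  simp only [volterra, map_smul]
  exact intervalIntegral.integral_smul c _

theorem integral_exp_decay_le {c t : ℝ} (hc : 0 < c) :
    ∫ s in (0 : ℝ)..t, Real.exp (-(c * (t - s))) ≤ 1 / c := by
  have hderiv : ∀ s ∈ Set.uIcc 0 t,
      HasDerivAt (fun s => Real.exp (-(c * (t - s))) / c) (Real.exp (-(c * (t - s)))) s := by
    intro s _
    have h1 : HasDerivAt (fun s => -(c * (t - s))) c s := by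
      have h0 := (((hasDerivAt_id s).const_sub t).const_mul c).neg
      rw [mul_neg_one, neg_neg] at h0
      exact h0
    have h2 := h1.exp.div_const c
    rwa [mul_div_cancel_right₀ _ hc.ne'] at h2
  rw [intervalIntegral.integral_eq_sub_of_hasDerivAt hderiv
    (Continuous.intervalIntegrable (by fun_prop) _ _)]
  simp only [sub_self, mul_zero, neg_zero, Real.exp_zero]
  have : 0 ≤ Real.exp (-(c * (t - 0))) / c := by positivity
  linarith

/-- Exponential decay makes the convolution kernel integrable with mass at most `1 / c`. The bound
is uniform in `t`, so the convolution acts on bounded functions over the whole half-line. -/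
theorem norm_volterra_le {c : ℝ} (hc : 0 < c)
    (hdecay : ∀ t, ‖T t‖ ≤ Real.exp (-(c * t))) {g : ℝ → X} {m : ℝ}
    (hm : ∀ s, ‖g s‖ ≤ m) {t : ℝ} (ht : 0 ≤ t) : ‖volterra T g t‖ ≤ m / c := by
  have hm0 : 0 ≤ m := (norm_nonneg _).trans (hm 0)
  have hcont : Continuous fun s : ℝ => Real.exp (-(c * (t - s))) * m := by fun_prop
  calc ‖volterra T g t‖ ≤ ∫ s in (0 : ℝ)..t, Real.exp (-(c * (t - s))) * m := by
        refine intervalIntegral.norm_integral_le_of_norm_le ht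
          (Eventually.of_forall fun s hs => ?_) (hcont.intervalIntegrable _ _)
        refine ((T (t - s).toNNReal).le_of_opNorm_le (hdecay _) _).trans ?_
        rw [Real.coe_toNNReal _ (sub_nonneg.2 hs.2)]
        exact mul_le_mul_of_nonneg_left (hm s) (Real.exp_pos _).le
    _ ≤ 1 / c * m := by
        rw [intervalIntegral.integral_mul_const]
        exact mul_le_mul_of_nonneg_right (integral_exp_decay_le hc) hm0
    _ = m / c := by ring

/-- Split the integral at `s`: the semigroup law extracts `T t` from the first piece, and
translation by `s` handles the second. -/
theorem IsC0Semigroup.volterra_shift [CompleteSpace X] (hT : IsC0Semigroup T) {g : ℝ → X}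
    (hg : Continuous g) (t s : ℝ≥0) :
    volterra T g (t + s) = T t (volterra T g s) + volterra T (fun r => g (r + s)) t := by
  have h1 : ∫ r in (0 : ℝ)..s, T (t + s - r : ℝ).toNNReal (g r) = T t (volterra T g s) := by
    rw [volterra, ← ContinuousLinearMap.intervalIntegral_comp_comm _
      (hT.intervalIntegrable_volterra hg _ _ _)]
    refine intervalIntegral.integral_congr fun r hr => ?_
    rw [Set.uIcc_of_le s.coe_nonneg] at hr
    have h2 : (t + s - r : ℝ).toNNReal = t + (s - r : ℝ).toNNReal := by
      rw [add_sub_assoc, Real.toNNReal_add t.coe_nonneg (sub_nonneg.2 hr.2), Real.toNNReal_coe]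
    simp only [h2, hT.add, ContinuousLinearMap.comp_apply]
  have h3 : ∫ r in (s : ℝ)..(t + s), T (t + s - r : ℝ).toNNReal (g r)
      = volterra T (fun r => g (r + s)) t := by
    have h4 := intervalIntegral.integral_comp_add_right (a := 0) (b := t)
      (fun r : ℝ => T (t + s - r : ℝ).toNNReal (g r)) s
    rw [zero_add] at h4
    rw [← h4, volterra]
    simp only [add_sub_add_right_eq_sub]
  rw [← h1, ← h3, volterra, intervalIntegral.integral_add_adjacent_intervals
    (hT.intervalIntegrable_volterra hg _ _ _) (hT.intervalIntegrable_volterra hg _ _ _)]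

theorem IsC0Semigroup.tendsto_inv_smul_volterra [CompleteSpace X] (hT : IsC0Semigroup T) {g : ℝ → X}
    (hg : Continuous g) :
    Tendsto (fun h : ℝ≥0 => (h : ℝ)⁻¹ • volterra T g h) (𝓝[>] 0) (𝓝 (g 0)) := by
  rw [Metric.tendsto_nhds]
  intro ε hε
  have hc := (hT.continuous_volterra_integrand hg).tendsto (0, 0)
  simp only [Function.uncurry, sub_zero, Real.toNNReal_zero, hT.zero,
    ContinuousLinearMap.id_apply] at hc
  obtain ⟨δ, hδ, hb⟩ := Metric.tendsto_nhds_nhds.1 hc (ε / 2) (half_pos hε)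
  have hlt : ∀ᶠ h : ℝ≥0 in 𝓝[>] 0, (h : ℝ) < δ :=
    (tendsto_coe_nhdsGT_zero.mono_right nhdsWithin_le_nhds).eventually (gt_mem_nhds hδ)
  filter_upwards [hlt, self_mem_nhdsWithin] with h hh (hpos : 0 < h)
  have hpos' : (0 : ℝ) < h := hpos
  have h1 : volterra T g h - (h : ℝ) • g 0
      = ∫ s in (0 : ℝ)..h, (T (h - s : ℝ).toNNReal (g s) - g 0) := by
    rw [intervalIntegral.integral_sub (hT.intervalIntegrable_volterra hg _ _ _)
      intervalIntegrable_const, intervalIntegral.integral_const, sub_zero, volterra]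
  have h2 : ‖volterra T g h - (h : ℝ) • g 0‖ ≤ ε / 2 * h := by
    rw [h1]
    have := intervalIntegral.norm_integral_le_of_norm_le_const (a := 0) (b := (h : ℝ))
      (C := ε / 2) (f := fun s : ℝ => T (h - s : ℝ).toNNReal (g s) - g 0) ?_
    · simpa [abs_of_pos hpos'] using this
    · intro s hs
      rw [Set.uIoc_of_le hpos'.le] at hs
      rw [← dist_eq_norm]
      refine (hb (x := ((h : ℝ), s)) ?_).le
      rw [Prod.dist_eq, max_lt_iff]
      simp only [dist_zero_right, Real.norm_eq_abs, abs_of_pos hpos', abs_of_pos hs.1]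
      exact ⟨hh, hs.2.trans_lt hh⟩
  rw [dist_eq_norm]
  have h3 : (h : ℝ)⁻¹ • volterra T g h - g 0
      = (h : ℝ)⁻¹ • (volterra T g h - (h : ℝ) • g 0) := by
    rw [smul_sub, inv_smul_smul₀ hpos'.ne']
  rw [h3, norm_smul, norm_inv, Real.norm_of_nonneg hpos'.le, inv_mul_lt_iff₀ hpos']
  nlinarith

/-! ### Bounded perturbations -/

/-- `S` solves the Volterra equation `S_t u = T_t u - ∫_0^t T_{t-s} B S_s u ds`. -/
def SolvesVolterra (T : ℝ≥0 → X →L[ℝ] X) (B : X →L[ℝ] X) (S : ℝ≥0 → X →L[ℝ] X) : Prop :=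
  ∀ t u, S t u = T t u - volterra T (fun s => B (S s.toNNReal u)) t

/-- Families of closed sets preserved by the Picard iteration contain the solution `S`. -/
def IsPicardLimit (T : ℝ≥0 → X →L[ℝ] X) (B : X →L[ℝ] X) (S : ℝ≥0 → X →L[ℝ] X) : Prop :=
  ∀ (u : X) (K : ℝ≥0 → Set X), (∀ t, IsClosed (K t)) → (∀ t, 0 ∈ K t) →
    (∀ f : ℝ≥0 → X, Continuous f → (∀ t, f t ∈ K t) →
      ∀ t : ℝ≥0, T t u - volterra T (fun s => B (f s.toNNReal)) t ∈ K t) →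
    ∀ t, S t u ∈ K t

theorem tendsto_iterate_sub_of_norm_lt_one [CompleteSpace X] {V : X →L[ℝ] X} (hV : ‖V‖ < 1)
    {f b : X} (hf : f + V f = b) :
    Tendsto (fun n => (fun g => b - V g)^[n] 0) atTop (𝓝 f) := by
  have hΦ : ContractingWith ‖V‖₊ (fun g => b - V g) := by
    refine ⟨hV, LipschitzWith.of_dist_le_mul fun g g' => ?_⟩
    rw [dist_sub_left, dist_eq_norm, dist_eq_norm, ← map_sub]
    exact V.le_opNorm _
  rw [hΦ.fixedPoint_unique (eq_sub_of_add_eq hf).symm]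
  exact hΦ.tendsto_iterate_fixedPoint 0

theorem IsC0Semigroup.exists_volterra_clm [CompleteSpace X] (hT : IsC0Semigroup T) {c : ℝ} (hc : 0 < c)
    (hdecay : ∀ t, ‖T t‖ ≤ Real.exp (-(c * t))) (B : X →L[ℝ] X) :
    ∃ V : (ℝ≥0 →ᵇ X) →L[ℝ] (ℝ≥0 →ᵇ X), ‖V‖ ≤ ‖B‖ / c ∧
      ∀ f (t : ℝ≥0), V f t = volterra T (fun s => B (f s.toNNReal)) t := by
  have hcont : ∀ f : ℝ≥0 →ᵇ X, Continuous fun s : ℝ => B (f s.toNNReal) := fun f => by fun_prop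
  have hbd : ∀ (f : ℝ≥0 →ᵇ X) (t : ℝ≥0),
      ‖volterra T (fun s => B (f s.toNNReal)) t‖ ≤ ‖B‖ * ‖f‖ / c := fun f t =>
    norm_volterra_le hc hdecay
      (fun s => (B.le_opNorm _).trans
        (mul_le_mul_of_nonneg_left (f.norm_coe_le_norm _) (norm_nonneg _))) t.coe_nonneg
  let V₀ : (ℝ≥0 →ᵇ X) →ₗ[ℝ] (ℝ≥0 →ᵇ X) :=
    { toFun := fun f => BoundedContinuousFunction.ofNormedAddCommGroup
        (fun t : ℝ≥0 => volterra T (fun s => B (f s.toNNReal)) t)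
        ((hT.continuous_volterra (hcont f)).comp NNReal.continuous_coe) _ (hbd f)
      map_add' := fun f g => by
        ext t
        simp only [BoundedContinuousFunction.coe_ofNormedAddCommGroup,
          BoundedContinuousFunction.coe_add, Pi.add_apply, map_add]
        exact hT.volterra_add (hcont f) (hcont g) t
      map_smul' := fun r f => by
        ext t
        simp only [BoundedContinuousFunction.coe_ofNormedAddCommGroup,
          BoundedContinuousFunction.coe_smul, map_smul, RingHom.id_apply]
        exact volterra_smul r _ t }
  refine ⟨V₀.mkContinuous (‖B‖ / c) fun f => ?_,
    LinearMap.mkContinuous_norm_le _ (by positivity) _, fun f t => rfl⟩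
  refine (BoundedContinuousFunction.norm_le (by positivity)).2 fun t => (hbd f t).trans_eq ?_
  ring

/-- On bounded continuous orbits the Volterra operator `V` has norm at most `‖B‖ / c < 1`, so `1 +
V` is invertible and `S` is the inverse applied to the orbits of `T`. Uniqueness of the solution
yields the semigroup law. -/
theorem IsC0Semigroup.exists_perturbation_of_decay [CompleteSpace X] (hT : IsC0Semigroup T) {c : ℝ}
    (hdecay : ∀ t, ‖T t‖ ≤ Real.exp (-(c * t))) (B : X →L[ℝ] X) (hB : ‖B‖ < c) :
    ∃ S, IsC0Semigroup S ∧ SolvesVolterra T B S ∧ IsPicardLimit T B S := by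
  have hc : 0 < c := (norm_nonneg B).trans_lt hB
  obtain ⟨V, hV, hVapp⟩ := hT.exists_volterra_clm hc hdecay B
  have hV1 : ‖V‖ < 1 := hV.trans_lt ((div_lt_one hc).2 hB)
  obtain ⟨w, hw⟩ : IsUnit (1 + V) := by
    have := isUnit_one_sub_of_norm_lt_one (x := -V) (by rwa [norm_neg])
    rwa [sub_neg_eq_add] at this
  set R : (ℝ≥0 →ᵇ X) →L[ℝ] (ℝ≥0 →ᵇ X) := ↑w⁻¹
  have hR : ∀ f, R f + V (R f) = f := fun f => by
    have : (1 + V) * R = 1 := by rw [← hw]; exact w.mul_inv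
    simpa using congrArg (fun L : (ℝ≥0 →ᵇ X) →L[ℝ] (ℝ≥0 →ᵇ X) => L f) this
  have hR' : ∀ f, R (f + V f) = f := fun f => by
    have : R * (1 + V) = 1 := by rw [← hw]; exact w.inv_mul
    simpa using congrArg (fun L : (ℝ≥0 →ᵇ X) →L[ℝ] (ℝ≥0 →ᵇ X) => L f) this
  have hbd : ∀ (u : X) (t : ℝ≥0), ‖T t u‖ ≤ 1 * ‖u‖ := fun u t =>
    (T t).le_of_opNorm_le ((hdecay t).trans (Real.exp_le_one_iff.2 (by
      have : 0 ≤ c * t := by positivity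
      linarith))) u
  let J₀ : X →ₗ[ℝ] (ℝ≥0 →ᵇ X) :=
    { toFun := fun u => BoundedContinuousFunction.ofNormedAddCommGroup
        (fun t : ℝ≥0 => T t u) (hT.continuous u) _ (hbd u)
      map_add' := fun u v => by ext t; simp
      map_smul' := fun r u => by ext t; simp }
  let J : X →L[ℝ] (ℝ≥0 →ᵇ X) := J₀.mkContinuous 1 fun u =>
    (BoundedContinuousFunction.norm_le (by positivity)).2 (hbd u)
  have hJ : ∀ u t, J u t = T t u := fun u t => rfl
  let S : ℝ≥0 → X →L[ℝ] X := fun t =>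
    (BoundedContinuousFunction.evalCLM ℝ t).comp (R.comp J)
  have hS : ∀ t u, S t u = R (J u) t := fun t u => rfl
  have hSV : SolvesVolterra T B S := fun t u => by
    have := congrArg (fun f : ℝ≥0 →ᵇ X => f t) (hR (J u))
    simp only [BoundedContinuousFunction.coe_add, Pi.add_apply, hVapp, hJ] at this
    exact eq_sub_of_add_eq this
  have hgc : ∀ u, Continuous fun s : ℝ => B (S s.toNNReal u) := fun u => by
    simp only [hS]; fun_prop
  have hS0 : ∀ u, S 0 u = u := fun u => by
    rw [hSV 0 u, hT.zero]
    simp [volterra]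
  refine ⟨S, ⟨?_, ?_, ?_⟩, hSV, ?_⟩
  · ext u
    exact hS0 u
  · intro t s
    ext u
    -- The orbit shifted by `s` solves the Volterra equation with initial value `S s u`, hence it is
    -- the orbit of `S s u`.
    let g : ℝ≥0 →ᵇ X := (R (J u)).compContinuous ⟨fun t => t + s, by fun_prop⟩
    have hg : ∀ t, g t = S (t + s) u := fun t => rfl
    have hgV : g + V g = J (S s u) := by
      ext t
      have hsh := hT.volterra_shift (hgc u) t s
      have hcongr : V g t = volterra T (fun r : ℝ => B (S (r + s).toNNReal u)) t := by
        rw [hVapp]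
        refine intervalIntegral.integral_congr fun r hr => ?_
        rw [Set.uIcc_of_le t.coe_nonneg] at hr
        simp only [hg, Real.toNNReal_add hr.1 s.coe_nonneg, Real.toNNReal_coe]
      rw [BoundedContinuousFunction.coe_add, Pi.add_apply, hcongr, hJ, hg, hSV (t + s) u,
        hSV s u, map_sub, NNReal.coe_add, hsh, hT.add, ContinuousLinearMap.comp_apply]
      abel
    have hgR : g = R (J (S s u)) := by rw [← hgV, hR']
    change R (J u) (t + s) = R (J (S s u)) t
    rw [← hgR]
    rfl
  · intro u
    have : Continuous fun t => S t u := (R (J u)).continuous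
    have h0 := (this.tendsto 0).mono_left (nhdsWithin_le_nhds (s := Set.Ioi 0))
    rwa [hS0] at h0
  · intro u K hK h0 hstep t
    let Φ : (ℝ≥0 →ᵇ X) → (ℝ≥0 →ᵇ X) := fun f => J u - V f
    -- The iteration starts at the zero function, which is why the sets `K t` are required to
    -- contain `0`.
    have hiter : ∀ n, ∀ t, (Φ^[n] 0) t ∈ K t := by
      intro n
      induction n with
      | zero => exact h0
      | succ n ih =>
        intro t
        rw [Function.iterate_succ_apply']
        have := hstep _ (Φ^[n] 0).continuous ih t
        simpa only [Φ, BoundedContinuousFunction.coe_sub, Pi.sub_apply, hVapp, hJ] using this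
    have hlim : Tendsto (fun n => Φ^[n] 0) atTop (𝓝 (R (J u))) :=
      tendsto_iterate_sub_of_norm_lt_one hV1 (hR (J u))
    exact (hK t).mem_of_tendsto
      (((BoundedContinuousFunction.evalCLM ℝ t).continuous.tendsto _).comp hlim)
      (Eventually.of_forall fun n => hiter n t)

theorem volterra_rescale (β : ℝ) (g : ℝ → X) {t : ℝ} (ht : 0 ≤ t) :
    volterra (expRescale β T) (fun s => Real.exp (β * s) • g s) t
      = Real.exp (β * t) • volterra T g t := by
  rw [volterra, volterra, ← intervalIntegral.integral_smul]
  refine intervalIntegral.integral_congr fun s hs => ?_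
  rw [Set.uIcc_of_le ht] at hs
  simp only [expRescale_apply, map_smul, smul_smul, ← Real.exp_add,
    Real.coe_toNNReal _ (sub_nonneg.2 hs.2)]
  congr 2
  ring

theorem volterra_congr {f g : ℝ → X} {t : ℝ} (ht : 0 ≤ t) (h : ∀ s, 0 ≤ s → f s = g s) :
    volterra T f t = volterra T g t := by
  refine intervalIntegral.integral_congr fun s hs => ?_
  rw [Set.uIcc_of_le ht] at hs
  simp only [h s hs.1]

theorem SolvesVolterra.rescale {B : X →L[ℝ] X} {S : ℝ≥0 → X →L[ℝ] X} (h : SolvesVolterra T B S)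
    (β : ℝ) : SolvesVolterra (expRescale β T) B (expRescale β S) := by
  intro t u
  have h1 : volterra (expRescale β T) (fun s => B (expRescale β S s.toNNReal u)) t
      = Real.exp (β * t) • volterra T (fun s => B (S s.toNNReal u)) t := by
    rw [← volterra_rescale _ _ t.coe_nonneg]
    refine volterra_congr t.coe_nonneg fun s hs => ?_
    rw [expRescale_apply, map_smul, Real.coe_toNNReal _ hs]
  rw [h1, expRescale_apply, expRescale_apply, h t u, smul_sub]

theorem IsPicardLimit.rescale {B : X →L[ℝ] X} {S : ℝ≥0 → X →L[ℝ] X} (h : IsPicardLimit T B S)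
    (β : ℝ) : IsPicardLimit (expRescale β T) B (expRescale β S) := by
  intro u K hK h0 hstep t
  -- Pulling the sets back along the scaling by `e^{βt}` reduces the claim to the unscaled
  -- iteration.
  refine h u (fun t => {v | Real.exp (β * t) • v ∈ K t})
    (fun t => (hK t).preimage (continuous_const_smul _)) (fun t => by simpa using h0 t) ?_ t
  intro f hf hfK t
  have := hstep (fun t => Real.exp (β * t) • f t) (by fun_prop) hfK t
  have h1 : volterra (expRescale β T)
      (fun s => B (Real.exp (β * s.toNNReal) • f s.toNNReal)) t
      = Real.exp (β * t) • volterra T (fun s => B (f s.toNNReal)) t := by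
    rw [← volterra_rescale _ _ t.coe_nonneg]
    refine volterra_congr t.coe_nonneg fun s hs => ?_
    rw [map_smul, Real.coe_toNNReal _ hs]
  rw [h1, expRescale_apply, ← smul_sub] at this
  exact this

theorem IsC0Semigroup.exists_perturbation [CompleteSpace X] (hT : IsC0Semigroup T) {ω : ℝ}
    (hω : ∀ t, ‖T t‖ ≤ Real.exp (ω * t)) (B : X →L[ℝ] X) :
    ∃ S, IsC0Semigroup S ∧ SolvesVolterra T B S ∧ IsPicardLimit T B S := by
  -- After rescaling by `e^{-βt}` the norm decays at rate `‖B‖ + 1`, strictly faster than `‖B‖`.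
  set β : ℝ := ω + ‖B‖ + 1
  obtain ⟨S, h1, h2, h3⟩ := (hT.rescale (-β)).exists_perturbation_of_decay (c := ‖B‖ + 1)
    (fun t => by
      rw [expRescale, norm_smul, Real.norm_of_nonneg (Real.exp_pos _).le]
      refine (mul_le_mul_of_nonneg_left (hω t) (Real.exp_pos _).le).trans_eq ?_
      rw [← Real.exp_add]
      congr 1
      simp only [β]
      ring) B (lt_add_one _)
  have hback : expRescale β (expRescale (-β) T) = T := by
    simpa using expRescale_neg_expRescale (-β) T
  exact ⟨_, h1.rescale β, hback ▸ h2.rescale β, hback ▸ h3.rescale β⟩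

/-- The difference of the two semigroups is the Volterra integral, whose mean over `[0, t]` tends to
the integrand at time zero, namely `B u`. -/
theorem SolvesVolterra.tendsto_inv_smul_sub {B : X →L[ℝ] X} {S : ℝ≥0 → X →L[ℝ] X}
    (h : SolvesVolterra T B S) [CompleteSpace X] (hT : IsC0Semigroup T) (hS : IsC0Semigroup S) (u : X) :
    Tendsto (fun t : ℝ≥0 => (t : ℝ)⁻¹ • (T t u - S t u)) (𝓝[>] 0) (𝓝 (B u)) := by
  have hc : Continuous fun s : ℝ => B (S s.toNNReal u) :=
    B.continuous.comp ((hS.continuous u).comp continuous_real_toNNReal)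
  have := hT.tendsto_inv_smul_volterra hc
  simp only [Real.toNNReal_zero, hS.zero, ContinuousLinearMap.id_apply] at this
  refine this.congr fun t => ?_
  rw [h t u, sub_sub_cancel]

theorem SolvesVolterra.generator_eq {B : X →L[ℝ] X} {S : ℝ≥0 → X →L[ℝ] X}
    (h : SolvesVolterra T B S) [CompleteSpace X] (hT : IsC0Semigroup T) (hS : IsC0Semigroup S) :
    generator S = (generator T).subBounded B := by
  refine generator_eq_subBounded fun u v => ⟨fun hv => ?_, fun hv => ?_⟩
  · refine (Tendsto.add hv (h.tendsto_inv_smul_sub hT hS u)).congr fun t => ?_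
    rw [← smul_add]
    congr 1
    abel
  · have := Tendsto.sub hv (h.tendsto_inv_smul_sub hT hS u)
    rw [add_sub_cancel_right] at this
    refine this.congr fun t => ?_
    rw [← smul_sub]
    congr 1
    abel

end Perturbation

end

/-! ### Order structure of `L²` and consequences of the transition function. -/

noncomputable section

section OrderedLTwo

variable {E : Type*} [MeasurableSpace E] {μ : Measure E}

theorem Lp.isOrderedModule : IsOrderedModule ℝ (Lp ℝ 2 μ) := by
  refine IsOrderedModule.of_smul_nonneg fun r hr f hf => ?_
  rw [← Lp.coeFn_nonneg] at hf ⊢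
  filter_upwards [hf, Lp.coeFn_smul r f] with x hx hx'
  rw [hx']
  exact mul_nonneg hr hx

theorem Lp.inner_le_inner_of_le {f g h : Lp ℝ 2 μ} (hf : 0 ≤ f) (hgh : g ≤ h) :
    inner ℝ f g ≤ inner ℝ f h := by
  rw [L2.inner_def, L2.inner_def]
  refine integral_mono_ae (L2.integrable_inner f g) (L2.integrable_inner f h) ?_
  filter_upwards [(Lp.coeFn_nonneg f).2 hf, (Lp.coeFn_le g h).2 hgh] with x hx hx'
  simp only [RCLike.inner_apply, conj_trivial]
  exact mul_le_mul_of_nonneg_right hx' hx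

theorem Lp.intervalIntegral_mono {F G : ℝ → Lp ℝ 2 μ} {t : ℝ} (ht : 0 ≤ t)
    (hF : IntervalIntegrable F volume 0 t) (hG : IntervalIntegrable G volume 0 t)
    (h : ∀ s ∈ Set.Ioc 0 t, F s ≤ G s) :
    ∫ s in (0 : ℝ)..t, F s ≤ ∫ s in (0 : ℝ)..t, G s := by
  have := Lp.isOrderedModule (μ := μ)
  rw [intervalIntegral.integral_of_le ht, intervalIntegral.integral_of_le ht]
  exact integral_mono_ae hF.1 hG.1 ((ae_restrict_iff' measurableSet_Ioc).2 (Eventually.of_forall h))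

theorem dense_memLp_top [IsFiniteMeasure μ] : Dense {v : Lp ℝ 2 μ | MemLp v ∞ μ} := by
  refine (Lp.simpleFunc.denseRange (E := ℝ) (μ := μ) (p := 2) (by norm_num)).mono ?_
  rintro _ ⟨f, rfl⟩
  exact (memLp_congr_ae (Lp.simpleFunc.toSimpleFunc_eq_toFun f)).1
    (SimpleFunc.memLp_top (Lp.simpleFunc.toSimpleFunc f) μ)

theorem ae_abs_le_eLpNorm_top {f : E → ℝ} (hf : MemLp f ∞ μ) :
    ∀ᵐ x ∂μ, |f x| ≤ (eLpNorm f ∞ μ).toReal := by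
  have h := ae_le_eLpNormEssSup (f := f) (μ := μ)
  rw [← eLpNorm_exponent_top] at h
  filter_upwards [h] with x hx
  have := ENNReal.toReal_mono hf.2.ne hx
  simpa using this

theorem eLpNorm_top_le_of_ae_abs_le {f : E → ℝ} {r : ℝ} (h : ∀ᵐ x ∂μ, |f x| ≤ r) :
    eLpNorm f ∞ μ ≤ ENNReal.ofReal r := by
  rw [eLpNorm_exponent_top]
  exact eLpNormEssSup_le_of_ae_bound h

variable {T : ℝ≥0 → Lp ℝ 2 μ →L[ℝ] Lp ℝ 2 μ}

theorem HasTransitionFunction.nonneg (hP : HasTransitionFunction T) (t : ℝ≥0) {f : Lp ℝ 2 μ}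
    (hf : 0 ≤ f) : 0 ≤ T t f := by
  obtain ⟨P, -, hP⟩ := hP
  have hm := Lp.aestronglyMeasurable f
  -- Nonnegativity `μ`-almost everywhere need not hold almost everywhere for `P t x`, so a
  -- representative that is nonnegative at every point is chosen.
  set g : E → ℝ := fun x => max (hm.mk f x) 0
  have hgm : Measurable g := hm.stronglyMeasurable_mk.measurable.max measurable_const
  have hgf : g =ᵐ[μ] f := by
    filter_upwards [hm.ae_eq_mk, (Lp.coeFn_nonneg f).2 hf] with x h1 h2
    simp only [g]
    rw [← h1]
    exact max_eq_left h2
  have hg : MemLp g 2 μ := (memLp_congr_ae hgf).2 (Lp.memLp f)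
  have heq : hg.toLp g = f := Lp.ext (hg.coeFn_toLp.trans hgf)
  rw [← Lp.coeFn_nonneg]
  filter_upwards [hP t g hgm hg] with x hx
  rw [← heq, hx.2]
  exact integral_nonneg fun y => le_max_right _ _

theorem HasTransitionFunction.mono (hP : HasTransitionFunction T) (t : ℝ≥0) {f g : Lp ℝ 2 μ}
    (hfg : f ≤ g) : T t f ≤ T t g := by
  have := hP.nonneg t (sub_nonneg.2 hfg)
  rwa [map_sub, sub_nonneg] at this

variable [IsFiniteMeasure μ]

/-- Sup-norm bounds become order intervals, which are closed in `L²` and compatible with positive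
operators and integrals. -/
theorem Lp.mem_Icc_smul_const_iff {v : Lp ℝ 2 μ} {r : ℝ} :
    v ∈ Set.Icc (-(r • Lp.const 2 μ (1 : ℝ))) (r • Lp.const 2 μ (1 : ℝ)) ↔
      ∀ᵐ x ∂μ, |v x| ≤ r := by
  have hc : (r • Lp.const 2 μ (1 : ℝ) : Lp ℝ 2 μ) =ᵐ[μ] fun _ => r := by
    filter_upwards [Lp.coeFn_smul r (Lp.const 2 μ (1 : ℝ)), Lp.coeFn_const 2 μ (1 : ℝ)]
      with x h1 h2
    rw [h1, Pi.smul_apply, h2, Function.const_apply, smul_eq_mul, mul_one]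
  rw [Set.mem_Icc, ← Lp.coeFn_le, ← Lp.coeFn_le]
  constructor
  · rintro ⟨h1, h2⟩
    filter_upwards [h1, h2, hc, Lp.coeFn_neg (r • Lp.const 2 μ (1 : ℝ))] with x h1 h2 h3 h4
    rw [h4, Pi.neg_apply, h3] at h1
    rw [h3] at h2
    exact abs_le.2 ⟨h1, h2⟩
  · intro h
    constructor
    · filter_upwards [h, hc, Lp.coeFn_neg (r • Lp.const 2 μ (1 : ℝ))] with x h1 h3 h4
      rw [h4, Pi.neg_apply, h3]
      exact (abs_le.1 h1).1
    · filter_upwards [h, hc] with x h1 h3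
      rw [h3]
      exact (abs_le.1 h1).2

/-! ### Semigroups given by transition functions -/

theorem HasTransitionFunction.const_one_le (hP : HasTransitionFunction T) (t : ℝ≥0) :
    T t (Lp.const 2 μ (1 : ℝ)) ≤ Lp.const 2 μ (1 : ℝ) := by
  obtain ⟨P, hP1, hP⟩ := hP
  have h1 : (memLp_const (1 : ℝ) : MemLp (fun _ : E => (1 : ℝ)) 2 μ).toLp _
      = Lp.const 2 μ (1 : ℝ) := rfl
  rw [← Lp.coeFn_le]
  filter_upwards [hP t _ measurable_const (memLp_const (1 : ℝ)),
    Lp.coeFn_const 2 μ (1 : ℝ)] with x hx hx'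
  rw [← h1, hx.2, h1, hx']
  simp only [integral_const, smul_eq_mul, mul_one, Function.const_apply]
  exact ENNReal.toReal_le_of_le_ofReal zero_le_one (by simpa using hP1 t x)

theorem HasTransitionFunction.mem_Icc (hP : HasTransitionFunction T) (t : ℝ≥0) {v : Lp ℝ 2 μ}
    {r : ℝ} (hr : 0 ≤ r)
    (hv : v ∈ Set.Icc (-(r • Lp.const 2 μ (1 : ℝ))) (r • Lp.const 2 μ (1 : ℝ))) :
    T t v ∈ Set.Icc (-(r • Lp.const 2 μ (1 : ℝ))) (r • Lp.const 2 μ (1 : ℝ)) := by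
  have := Lp.isOrderedModule (μ := μ)
  have h1 : T t (r • Lp.const 2 μ (1 : ℝ)) ≤ r • Lp.const 2 μ (1 : ℝ) := by
    rw [map_smul]
    exact smul_le_smul_of_nonneg_left (hP.const_one_le t) hr
  refine ⟨?_, (hP.mono t hv.2).trans h1⟩
  have h2 := hP.mono t hv.1
  rw [map_neg] at h2
  exact (neg_le_neg h1).trans h2

/-- With `m` the integral of `f`, expanding `∫ (f - m)² ≥ 0` gives `∫ f² ≥ 2m² - m² P(E) ≥ m²`,
because the mass is at most one. -/
theorem sq_integral_le_integral_sq {P : Measure E} [IsFiniteMeasure P] (hP : P Set.univ ≤ 1)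
    {f : E → ℝ} (hf : Integrable f P) (hf2 : Integrable (fun y => f y * f y) P) :
    (∫ y, f y ∂P) ^ 2 ≤ ∫ y, f y * f y ∂P := by
  set m := ∫ y, f y ∂P with hm
  have h0 : 0 ≤ ∫ y, (f y - m) ^ 2 ∂P := integral_nonneg fun y => sq_nonneg _
  have h1 : ∫ y, (f y - m) ^ 2 ∂P = ∫ y, f y * f y ∂P - 2 * m * m + m ^ 2 * P.real Set.univ := by
    have : ∀ y, (f y - m) ^ 2 = f y * f y - 2 * m * f y + m ^ 2 := fun y => by ring
    simp only [this]
    rw [integral_add (f := fun y => f y * f y - 2 * m * f y) (hf2.sub (hf.const_mul _))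
      (integrable_const _), integral_sub hf2 (hf.const_mul _), integral_const_mul, integral_const, smul_eq_mul, ← hm]
    ring
  have h2 : P.real Set.univ ≤ 1 :=
    ENNReal.toReal_le_of_le_ofReal zero_le_one (by simpa using hP)
  nlinarith [sq_nonneg m]

theorem Lp.norm_sq_eq_inner_one {v w : Lp ℝ 2 μ} (hw : w =ᵐ[μ] fun x => v x * v x) :
    ‖v‖ ^ 2 = inner ℝ w (Lp.const 2 μ (1 : ℝ)) := by
  rw [← real_inner_self_eq_norm_sq, L2.inner_def, L2.inner_def]
  refine integral_congr_ae ?_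
  filter_upwards [hw, Lp.coeFn_const 2 μ (1 : ℝ)] with x h1 h2
  simp only [RCLike.inner_apply, conj_trivial, h1, h2, Function.const_apply, one_mul]

/-- Here `w` is the class of `v²`, which lies in `L²` because `v` is bounded. The inequality is
Cauchy–Schwarz in each kernel, integrated against `μ`. -/
theorem HasTransitionFunction.exists_sq (hP : HasTransitionFunction T) {v : Lp ℝ 2 μ}
    (hv : MemLp v ∞ μ) : ∃ w : Lp ℝ 2 μ, 0 ≤ w ∧ (w =ᵐ[μ] fun x => v x * v x) ∧
      ∀ t, ‖T t v‖ ^ 2 ≤ inner ℝ (T t w) (Lp.const 2 μ (1 : ℝ)) := by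
  obtain ⟨P, hP1, hP⟩ := hP
  have hm := Lp.aestronglyMeasurable v
  set g : E → ℝ := hm.mk v
  have hgm : Measurable g := hm.stronglyMeasurable_mk.measurable
  have hgv : g =ᵐ[μ] v := hm.ae_eq_mk.symm
  have hg : MemLp g 2 μ := (memLp_congr_ae hgv).2 (Lp.memLp v)
  have hg2 : MemLp (fun x => g x * g x) 2 μ := hg.mul' ((memLp_congr_ae hgv).2 hv)
  have heq : hg.toLp g = v := Lp.ext (hg.coeFn_toLp.trans hgv)
  have hw : hg2.toLp _ =ᵐ[μ] fun x => v x * v x := by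
    filter_upwards [hg2.coeFn_toLp, hgv] with x h1 h2
    rw [h1, h2]
  refine ⟨hg2.toLp _, ?_, hw, fun t => ?_⟩
  · rw [← Lp.coeFn_nonneg]
    filter_upwards [hw] with x hx
    rw [hx]
    exact mul_self_nonneg _
  · rw [← real_inner_self_eq_norm_sq, L2.inner_def, L2.inner_def]
    refine integral_mono_ae (L2.integrable_inner _ _) (L2.integrable_inner _ _) ?_
    filter_upwards [hP t g hgm hg, hP t _ (hgm.mul hgm) hg2, Lp.coeFn_const 2 μ (1 : ℝ)]
      with x h1 h2 h3
    rw [heq] at h1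
    have : IsFiniteMeasure (P t x) := ⟨(hP1 t x).trans_lt ENNReal.one_lt_top⟩
    simp only [RCLike.inner_apply, conj_trivial, h1.2, h3, Function.const_apply, one_mul]
    rw [← sq]
    refine le_of_le_of_eq ?_ h2.2.symm
    exact sq_integral_le_integral_sq (hP1 t x) h1.1 h2.1

theorem tendsto_sub_toNNReal_nhdsGT (x : ℝ) :
    Tendsto (fun z : ℝ => (z - x).toNNReal) (𝓝[>] x) (𝓝[>] 0) := by
  refine tendsto_nhdsWithin_iff.2 ⟨?_, ?_⟩
  · have : Continuous fun z : ℝ => (z - x).toNNReal := by fun_prop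
    simpa using (this.tendsto x).mono_left nhdsWithin_le_nhds
  · filter_upwards [self_mem_nhdsWithin] with z hz
    exact Real.toNNReal_pos.2 (sub_pos.2 hz)

/-- Moving a time increment onto `1` by duality shows that `⟨T_t f, 1⟩` has right derivative `⟨T_t
f, a⟩`. Positivity of `T_t f` bounds this by `c ⟨T_t f, 1⟩`, and Gronwall applies. -/
theorem IsC0Semigroup.inner_one_le (hT : IsC0Semigroup T) (hP : HasTransitionFunction T)
    {a : Lp ℝ 2 μ} (ha : HasGenLimit (dualSemigroup T) (Lp.const 2 μ (1 : ℝ)) a) {c : ℝ}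
    (hac : a ≤ c • Lp.const 2 μ (1 : ℝ)) {f : Lp ℝ 2 μ} (hf : 0 ≤ f) (t : ℝ≥0) :
    inner ℝ (T t f) (Lp.const 2 μ (1 : ℝ))
      ≤ Real.exp (c * t) * inner ℝ f (Lp.const 2 μ (1 : ℝ)) := by
  set e := Lp.const 2 μ (1 : ℝ)
  set φ : ℝ → ℝ := fun x => inner ℝ (T x.toNNReal f) e
  have hφ : Continuous φ :=
    ((hT.continuous f).comp continuous_real_toNNReal).inner continuous_const
  have hslope : ∀ x : ℝ, 0 ≤ x → Tendsto (fun z => (z - x)⁻¹ * (φ z - φ x)) (𝓝[>] x)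
      (𝓝 (inner ℝ (T x.toNNReal f) a)) := by
    intro x hx
    have h1 := (tendsto_const_nhds (x := T x.toNNReal f)).inner
      (ha.comp (tendsto_sub_toNNReal_nhdsGT x)) (𝕜 := ℝ)
    refine h1.congr' ?_
    filter_upwards [self_mem_nhdsWithin] with z (hz : x < z)
    have hz' : 0 ≤ z - x := (sub_pos.2 hz).le
    have h2 : z.toNNReal = (z - x).toNNReal + x.toNNReal := by
      rw [← Real.toNNReal_add hz' hx, sub_add_cancel]
    simp only [Function.comp_apply, φ, h2, hT.add, ContinuousLinearMap.comp_apply, dualSemigroup,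
      inner_smul_right, inner_sub_right, ContinuousLinearMap.adjoint_inner_right,
      Real.coe_toNNReal _ hz']
  have key := le_gronwallBound_of_liminf_deriv_right_le (f := φ)
    (f' := fun x => inner ℝ (T x.toNNReal f) a) (δ := φ 0) (K := c) (ε := 0) (a := 0) (b := t)
    hφ.continuousOn
    (fun x hx r hr => ((hslope x hx.1).eventually (gt_mem_nhds hr)).frequently) le_rfl
    (fun x _ => by
      rw [add_zero]
      refine (Lp.inner_le_inner_of_le (hP.nonneg _ hf) hac).trans_eq ?_
      rw [inner_smul_right]) t ⟨t.coe_nonneg, le_rfl⟩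
  rw [gronwallBound_ε0, sub_zero, mul_comm] at key
  simpa [φ, hT.zero] using key

theorem IsC0Semigroup.norm_le_exp (hT : IsC0Semigroup T) (hP : HasTransitionFunction T)
    {a : Lp ℝ 2 μ} (ha : HasGenLimit (dualSemigroup T) (Lp.const 2 μ (1 : ℝ)) a) {C : ℝ}
    (hac : a ≤ (2 * C) • Lp.const 2 μ (1 : ℝ)) (t : ℝ≥0) : ‖T t‖ ≤ Real.exp (C * t) := by
  refine ContinuousLinearMap.opNorm_le_bound _ (Real.exp_pos _).le fun v => ?_
  refine dense_memLp_top.induction (P := fun v => ‖T t v‖ ≤ Real.exp (C * t) * ‖v‖) ?_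
    (isClosed_le (by fun_prop) (by fun_prop)) v
  intro v hv
  obtain ⟨w, hw0, hw, hwT⟩ := hP.exists_sq hv
  -- The squared norm grows at rate at most `2C`; taking the root leaves `C`.
  refine (sq_le_sq₀ (norm_nonneg _) (by positivity)).1 ?_
  refine (hwT t).trans ((hT.inner_one_le hP ha hac hw0 t).trans_eq ?_)
  rw [← Lp.norm_sq_eq_inner_one hw, mul_pow, ← Real.exp_nat_mul]
  congr 2
  push_cast
  ring

end OrderedLTwo

end

/-! ### Subtracting half of the dual unit: sup bounds and contractivity. -/

noncomputable section

section DualUnit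

variable {E : Type*} [MeasurableSpace E] {μ : Measure E}

theorem coeFn_mulBounded (a : E → ℝ) (ha : MemLp a ∞ μ) (v : Lp ℝ 2 μ) :
    mulBounded a ha v =ᵐ[μ] fun x => a x * v x := by
  have h := (ContinuousLinearMap.mul ℝ ℝ).coeFn_holder (r := 2) (ha.toLp a) v
  filter_upwards [h, ha.coeFn_toLp] with x h1 h2
  refine Eq.trans h1 ?_
  rw [h2]
  rfl

theorem coeFn_half_mulBounded (a : E → ℝ) (ha : MemLp a ∞ μ) (v : Lp ℝ 2 μ) :
    ((1 / 2 : ℝ) • mulBounded a ha) v =ᵐ[μ] fun x => 1 / 2 * (a x * v x) := by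
  filter_upwards [Lp.coeFn_smul (1 / 2 : ℝ) (mulBounded a ha v), coeFn_mulBounded a ha v]
    with x h1 h2
  refine Eq.trans h1 ?_
  rw [Pi.smul_apply, h2, smul_eq_mul]

/-- This is the cancellation that dictates the factor one half: the growth `⟨v², a⟩` permitted by
duality equals the loss `2⟨v, (a/2) v⟩` caused by the perturbation. -/
theorem inner_sq_eq_inner_two_smul {a : Lp ℝ 2 μ} {ha : MemLp a ∞ μ}
    {v w : Lp ℝ 2 μ} (hw : w =ᵐ[μ] fun x => v x * v x) :
    inner ℝ w a = inner ℝ (v + v) (((1 / 2 : ℝ) • mulBounded a ha) v) := by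
  rw [L2.inner_def, L2.inner_def]
  refine integral_congr_ae ?_
  filter_upwards [hw, coeFn_half_mulBounded a ha v, Lp.coeFn_add v v] with x h1 h2 h3
  simp only [RCLike.inner_apply, conj_trivial, h1, h2, h3, Pi.add_apply]
  ring

variable [IsFiniteMeasure μ] {T S : ℝ≥0 → Lp ℝ 2 μ →L[ℝ] Lp ℝ 2 μ} {a : Lp ℝ 2 μ}
  {ha : MemLp a ∞ μ} {C : ℝ}

theorem half_mulBounded_mem_Icc (haC : ∀ᵐ x ∂μ, |a x| ≤ 2 * C) {v : Lp ℝ 2 μ} {r : ℝ}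
    (hC : 0 ≤ C)
    (hv : v ∈ Set.Icc (-(r • Lp.const 2 μ (1 : ℝ))) (r • Lp.const 2 μ (1 : ℝ))) :
    ((1 / 2 : ℝ) • mulBounded a ha) v ∈
      Set.Icc (-((C * r) • Lp.const 2 μ (1 : ℝ))) ((C * r) • Lp.const 2 μ (1 : ℝ)) := by
  rw [Lp.mem_Icc_smul_const_iff] at hv ⊢
  filter_upwards [haC, hv, coeFn_half_mulBounded a ha v] with x h1 h2 h3
  rw [h3, abs_mul, abs_mul, abs_of_pos (by norm_num : (0 : ℝ) < 1 / 2)]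
  have := mul_le_mul h1 h2 (abs_nonneg _) (by positivity)
  linarith

/-- The radius `r e^{Ct}` solves `ρ(t) = r + ∫_0^t C ρ(s) ds`, so the Picard step reproduces it
exactly. -/
theorem integral_mul_exp_mul (C r t : ℝ) :
    ∫ s in (0 : ℝ)..t, C * (r * Real.exp (C * s)) = r * Real.exp (C * t) - r := by
  have hderiv : ∀ s ∈ Set.uIcc 0 t,
      HasDerivAt (fun s => r * Real.exp (C * s)) (C * (r * Real.exp (C * s))) s := by
    intro s _
    have h1 : HasDerivAt (fun s => C * s) C s := by simpa using (hasDerivAt_id s).const_mul C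
    refine (h1.exp.const_mul r).congr_deriv ?_
    ring
  rw [intervalIntegral.integral_eq_sub_of_hasDerivAt hderiv
    (Continuous.intervalIntegrable (by fun_prop) _ _)]
  simp

theorem volterra_mem_Icc (hT : IsC0Semigroup T) (hP : HasTransitionFunction T)
    (haC : ∀ᵐ x ∂μ, |a x| ≤ 2 * C) (hC : 0 ≤ C) {r : ℝ} (hr : 0 ≤ r) {f : ℝ≥0 → Lp ℝ 2 μ}
    (hf : Continuous f)
    (hfK : ∀ t : ℝ≥0, f t ∈ Set.Icc (-((r * Real.exp (C * t)) • Lp.const 2 μ (1 : ℝ)))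
      ((r * Real.exp (C * t)) • Lp.const 2 μ (1 : ℝ))) (t : ℝ≥0) :
    volterra T (fun s => ((1 / 2 : ℝ) • mulBounded a ha) (f s.toNNReal)) t ∈
      Set.Icc (-((r * Real.exp (C * t) - r) • Lp.const 2 μ (1 : ℝ)))
        ((r * Real.exp (C * t) - r) • Lp.const 2 μ (1 : ℝ)) := by
  have hmem : ∀ s ∈ Set.Ioc (0 : ℝ) t,
      T (t - s).toNNReal (((1 / 2 : ℝ) • mulBounded a ha) (f s.toNNReal)) ∈
      Set.Icc (-((C * (r * Real.exp (C * s))) • Lp.const 2 μ (1 : ℝ)))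
        ((C * (r * Real.exp (C * s))) • Lp.const 2 μ (1 : ℝ)) := by
    intro s hs
    refine hP.mem_Icc _ (by positivity) (half_mulBounded_mem_Icc haC hC ?_)
    simpa [Real.coe_toNNReal _ hs.1.le] using hfK s.toNNReal
  have hint := hT.intervalIntegrable_volterra
    (g := fun s => ((1 / 2 : ℝ) • mulBounded a ha) (f s.toNNReal))
    (((1 / 2 : ℝ) • mulBounded a ha).continuous.comp (hf.comp continuous_real_toNNReal)) t 0 t
  have hcont : Continuous fun s : ℝ => (C * (r * Real.exp (C * s))) • Lp.const 2 μ (1 : ℝ) := by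
    fun_prop
  have heq : ∫ s in (0 : ℝ)..t, (C * (r * Real.exp (C * s))) • Lp.const 2 μ (1 : ℝ)
      = (r * Real.exp (C * t) - r) • Lp.const 2 μ (1 : ℝ) := by
    rw [intervalIntegral.integral_smul_const, integral_mul_exp_mul]
  constructor
  · rw [← heq, ← intervalIntegral.integral_neg]
    exact Lp.intervalIntegral_mono t.coe_nonneg (hcont.neg.intervalIntegrable _ _) hint
      fun s hs => (hmem s hs).1
  · rw [← heq]
    exact Lp.intervalIntegral_mono t.coe_nonneg hint (hcont.intervalIntegrable _ _)
      fun s hs => (hmem s hs).2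

theorem IsPicardLimit.ae_abs_le (hT : IsC0Semigroup T) (hP : HasTransitionFunction T)
    (hS : IsPicardLimit T ((1 / 2 : ℝ) • mulBounded a ha) S)
    (haC : ∀ᵐ x ∂μ, |a x| ≤ 2 * C) (hC : 0 ≤ C) {r : ℝ} (hr : 0 ≤ r) {g : Lp ℝ 2 μ}
    (hg : ∀ᵐ x ∂μ, |g x| ≤ r) (t : ℝ≥0) : ∀ᵐ x ∂μ, |S t g x| ≤ r * Real.exp (C * t) := by
  rw [← Lp.mem_Icc_smul_const_iff]
  refine hS g (fun t => Set.Icc (-((r * Real.exp (C * t)) • Lp.const 2 μ (1 : ℝ)))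
    ((r * Real.exp (C * t)) • Lp.const 2 μ (1 : ℝ))) (fun t => isClosed_Icc) (fun t => ?_)
    (fun f hf hfK t => ?_) t
  · rw [Lp.mem_Icc_smul_const_iff]
    filter_upwards [Lp.coeFn_zero ℝ 2 μ] with x hx
    rw [hx, Pi.zero_apply, abs_zero]
    positivity
  · have h1 := hP.mem_Icc t hr (Lp.mem_Icc_smul_const_iff.2 hg)
    have h2 := volterra_mem_Icc (ha := ha) hT hP haC hC hr hf hfK t
    have h3 : (r * Real.exp (C * t)) • Lp.const 2 μ (1 : ℝ)
        = r • Lp.const 2 μ (1 : ℝ) + (r * Real.exp (C * t) - r) • Lp.const 2 μ (1 : ℝ) := by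
      rw [← add_smul]
      congr 1
      ring
    rw [h3]
    constructor
    · rw [neg_add, ← sub_eq_add_neg]
      exact sub_le_sub h1.1 h2.2
    · rw [← sub_neg_eq_add]
      exact sub_le_sub h1.2 h2.1

/-- The upper right derivative of `‖S_t v‖²` at `t = 0` is at most zero for bounded `v`. -/
theorem SolvesVolterra.eventually_slope_norm_sq_lt (hT : IsC0Semigroup T)
    (hP : HasTransitionFunction T) (hS : IsC0Semigroup S)
    (hV : SolvesVolterra T ((1 / 2 : ℝ) • mulBounded a ha) S)
    (hgen : HasGenLimit (dualSemigroup T) (Lp.const 2 μ (1 : ℝ)) a) {v : Lp ℝ 2 μ}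
    (hv : MemLp v ∞ μ) {r : ℝ} (hr : 0 < r) :
    ∀ᶠ t : ℝ≥0 in 𝓝[>] 0, (t : ℝ)⁻¹ * (‖S t v‖ ^ 2 - ‖v‖ ^ 2) < r := by
  obtain ⟨w, -, hw, hwT⟩ := hP.exists_sq hv
  -- The first term is the difference quotient of `⟨T_t w, 1⟩`, which dominates that of `‖T_t v‖²`;
  -- the second is the difference quotient of `‖T_t v‖² - ‖S_t v‖²`. Their limits cancel.
  have hlim : Tendsto (fun t : ℝ≥0 =>
      inner ℝ w ((t : ℝ)⁻¹ • (dualSemigroup T t (Lp.const 2 μ (1 : ℝ)) - Lp.const 2 μ (1 : ℝ)))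
        - inner ℝ (T t v + S t v) ((t : ℝ)⁻¹ • (T t v - S t v))) (𝓝[>] 0) (𝓝 0) := by
    have h1 := (tendsto_const_nhds (x := w)).inner hgen (𝕜 := ℝ)
    have h2 := ((hT.tendsto v).add (hS.tendsto v)).inner (hV.tendsto_inv_smul_sub hT hS v) (𝕜 := ℝ)
    have h3 := h1.sub h2
    rwa [inner_sq_eq_inner_two_smul (ha := ha) hw, sub_self] at h3
  filter_upwards [hlim.eventually (gt_mem_nhds hr)] with t ht
  refine lt_of_le_of_lt ?_ ht
  have h4 : inner ℝ (T t v + S t v) (T t v - S t v) = ‖T t v‖ ^ 2 - ‖S t v‖ ^ 2 := by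
    rw [inner_add_left, inner_sub_right, inner_sub_right, real_inner_self_eq_norm_sq,
      real_inner_self_eq_norm_sq, real_inner_comm]
    ring
  rw [inner_smul_right, inner_smul_right, h4, inner_sub_right, dualSemigroup,
    ContinuousLinearMap.adjoint_inner_right, ← Lp.norm_sq_eq_inner_one hw, ← mul_sub]
  refine mul_le_mul_of_nonneg_left ?_ (inv_nonneg.2 t.coe_nonneg)
  linarith [hwT t]

/-- Invariance of `L^∞` under `S` lets the slope estimate at time zero be restarted from `S_x v` at
every time `x`; Gronwall with zero growth rate then gives monotonicity, and density removes
boundedness of `v`. -/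
theorem SolvesVolterra.norm_le (hT : IsC0Semigroup T)
    (hP : HasTransitionFunction T) (hS : IsC0Semigroup S)
    (hV : SolvesVolterra T ((1 / 2 : ℝ) • mulBounded a ha) S)
    (hgen : HasGenLimit (dualSemigroup T) (Lp.const 2 μ (1 : ℝ)) a)
    (htop : ∀ (t : ℝ≥0) (v : Lp ℝ 2 μ), MemLp v ∞ μ → MemLp (S t v) ∞ μ) (t : ℝ≥0) (v : Lp ℝ 2 μ) :
    ‖S t v‖ ≤ ‖v‖ := by
  refine dense_memLp_top.induction (P := fun v => ‖S t v‖ ≤ ‖v‖) ?_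
    (isClosed_le (by fun_prop) (by fun_prop)) v
  intro v hv
  set φ : ℝ → ℝ := fun x => ‖S x.toNNReal v‖ ^ 2
  have hφ : Continuous φ :=
    ((hS.continuous v).comp continuous_real_toNNReal).norm.pow 2
  have hslope : ∀ x : ℝ, 0 ≤ x → ∀ r : ℝ, 0 < r →
      ∀ᶠ z in 𝓝[>] x, (z - x)⁻¹ * (φ z - φ x) < r := by
    intro x hx r hr
    have h1 := (tendsto_sub_toNNReal_nhdsGT x).eventually
      (hV.eventually_slope_norm_sq_lt hT hP hS hgen (htop x.toNNReal v hv) hr)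
    filter_upwards [h1, self_mem_nhdsWithin] with z hz1 (hz : x < z)
    have hz' : 0 ≤ z - x := (sub_pos.2 hz).le
    have h2 : z.toNNReal = (z - x).toNNReal + x.toNNReal := by
      rw [← Real.toNNReal_add hz' hx, sub_add_cancel]
    simpa only [φ, h2, hS.add, ContinuousLinearMap.comp_apply, Real.coe_toNNReal _ hz'] using hz1
  have key := le_gronwallBound_of_liminf_deriv_right_le (f := φ) (f' := fun _ => 0)
    (δ := φ 0) (K := 0) (ε := 0) (a := 0) (b := t) hφ.continuousOn
    (fun x hx r hr => (hslope x hx.1 r hr).frequently) le_rfl (fun x _ => by simp) t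
    ⟨t.coe_nonneg, le_rfl⟩
  rw [gronwallBound_ε0, zero_mul, Real.exp_zero, mul_one] at key
  simp only [φ, Real.toNNReal_coe, Real.toNNReal_zero, hS.zero,
    ContinuousLinearMap.id_apply] at key
  exact (sq_le_sq₀ (norm_nonneg _) (norm_nonneg _)).1 key

theorem le_smul_const_of_ae_abs_le {c : ℝ} (h : ∀ᵐ x ∂μ, |a x| ≤ c) :
    a ≤ c • Lp.const 2 μ (1 : ℝ) :=
  (Lp.mem_Icc_smul_const_iff.2 h).2

theorem IsC0Semigroup.exists_contraction_subBounded_half (hT : IsC0Semigroup T)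
    (hP : HasTransitionFunction T)
    (hgen : HasGenLimit (dualSemigroup T) (Lp.const 2 μ (1 : ℝ)) a) (ha : MemLp a ∞ μ)
    (hC : 0 ≤ C) (haC : ∀ᵐ x ∂μ, |a x| ≤ 2 * C) :
    ∃ S : ℝ≥0 → Lp ℝ 2 μ →L[ℝ] Lp ℝ 2 μ, IsContractionSemigroup S ∧
      generator S = (generator T).subBounded ((1 / 2 : ℝ) • mulBounded a ha) ∧
      ∀ (t : ℝ≥0) (g : Lp ℝ 2 μ), MemLp g ∞ μ →
        eLpNorm (S t g) ∞ μ ≤ ENNReal.ofReal (Real.exp (C * t)) * eLpNorm g ∞ μ := by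
  obtain ⟨S, hS, hV, hpic⟩ := hT.exists_perturbation
    (hT.norm_le_exp hP hgen (le_smul_const_of_ae_abs_le haC)) ((1 / 2 : ℝ) • mulBounded a ha)
  have htop : ∀ (t : ℝ≥0) (g : Lp ℝ 2 μ), MemLp g ∞ μ →
      eLpNorm (S t g) ∞ μ ≤ ENNReal.ofReal (Real.exp (C * t)) * eLpNorm g ∞ μ := by
    intro t g hg
    have h1 := hpic.ae_abs_le hT hP haC hC ENNReal.toReal_nonneg (ae_abs_le_eLpNorm_top hg) t
    refine (eLpNorm_top_le_of_ae_abs_le h1).trans_eq ?_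
    rw [mul_comm, ENNReal.ofReal_mul (Real.exp_pos _).le, ENNReal.ofReal_toReal hg.2.ne]
  refine ⟨S, ⟨hS, hV.norm_le hT hP hS hgen fun t g hg => ?_⟩, hV.generator_eq hT hS, htop⟩
  exact ⟨Lp.aestronglyMeasurable _,
    (htop t g hg).trans_lt (ENNReal.mul_lt_top ENNReal.ofReal_lt_top hg.2)⟩

theorem IsC0Semigroup.exists_contraction_subBounded_smul_id {X : Type*} [NormedAddCommGroup X]
    [NormedSpace ℝ X] {T : ℝ≥0 → X →L[ℝ] X} (hT : IsC0Semigroup T) {ω α : ℝ}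
    (hω : ∀ t, ‖T t‖ ≤ Real.exp (ω * t)) (hα : ω ≤ α) :
    ∃ S : ℝ≥0 → X →L[ℝ] X, IsContractionSemigroup S ∧
      generator S = (generator T).subBounded (α • ContinuousLinearMap.id ℝ X) := by
  refine ⟨expRescale (-α) T, ⟨hT.rescale _, fun t u => ?_⟩, generator_eq_subBounded fun u v => ?_⟩
  · rw [expRescale_apply, norm_smul, Real.norm_of_nonneg (Real.exp_pos _).le]
    calc Real.exp (-α * t) * ‖T t u‖ ≤ Real.exp (-α * t) * (Real.exp (ω * t) * ‖u‖) :=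
          mul_le_mul_of_nonneg_left ((T t).le_of_opNorm_le (hω t) u) (Real.exp_pos _).le
      _ = Real.exp ((ω - α) * t) * ‖u‖ := by
          rw [← mul_assoc, ← Real.exp_add]
          congr 2
          ring
      _ ≤ ‖u‖ := mul_le_of_le_one_left (norm_nonneg _) (Real.exp_le_one_iff.2
          (mul_nonpos_of_nonpos_of_nonneg (sub_nonpos.2 hα) t.coe_nonneg))
  · rw [hasGenLimit_expRescale_iff, neg_smul, sub_neg_eq_add]
    rfl

end DualUnit

/-! ### The constant `C` and the bounds on the dual units. -/

namespace DualUnitCondition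

variable {E : Type*} [MeasurableSpace E] {M : MeasureSequence E} {F : TestSpace M}
  {T : ∀ n, ℝ≥0 → Lp ℝ 2 (M.meas n) →L[ℝ] Lp ℝ 2 (M.meas n)}

theorem constC_nonneg (h : DualUnitCondition F T) : 0 ≤ h.constC := ENNReal.toReal_nonneg

theorem eLpNorm_dualOneAt_le (h : DualUnitCondition F T) (n : ℕ) :
    (eLpNorm (h.dualOneAt n) ∞ (M.meas n)).toReal ≤ 2 * h.constC := by
  -- Finiteness is essential: `toReal` sends `∞` to `0`, so otherwise the real constant would bound
  -- nothing.
  have hfin : (eLpNorm (h.dualOneAt 0) ∞ (M.meas 0) / 2 ⊔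
      ⨆ (n : ℕ) (_ : 1 ≤ n), eLpNorm (h.dualOneAt n) ∞ (M.meas n) / 2) ≠ ∞ := by
    refine (max_lt (ENNReal.div_lt_top (h.memLp_top 0).2.ne two_ne_zero)
      (lt_of_le_of_lt ?_ h.iSup_lt_top)).ne
    exact iSup₂_mono fun n _ => ENNReal.half_le_self
  have hle : eLpNorm (h.dualOneAt n) ∞ (M.meas n) / 2 ≤
      (eLpNorm (h.dualOneAt 0) ∞ (M.meas 0) / 2 ⊔
      ⨆ (n : ℕ) (_ : 1 ≤ n), eLpNorm (h.dualOneAt n) ∞ (M.meas n) / 2) := by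
    rcases Nat.eq_zero_or_pos n with rfl | hn
    · exact le_sup_left
    · exact le_trans (le_iSup₂ (f := fun (n : ℕ) (_ : 1 ≤ n) =>
        eLpNorm (h.dualOneAt n) ∞ (M.meas n) / 2) n hn) le_sup_right
  have := ENNReal.toReal_mono hfin hle
  rw [ENNReal.toReal_div, ENNReal.toReal_ofNat, div_le_iff₀ two_pos] at this
  rw [mul_comm]
  exact this

theorem ae_abs_dualOneAt_le (h : DualUnitCondition F T) (n : ℕ) :
    ∀ᵐ x ∂(M.meas n), |h.dualOneAt n x| ≤ 2 * h.constC := by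
  filter_upwards [ae_abs_le_eLpNorm_top (h.memLp_top n)] with x hx
  exact hx.trans (h.eLpNorm_dualOneAt_le n)

theorem hasGenLimit_dualOneAt (h : DualUnitCondition F T) (n : ℕ) :
    HasGenLimit (dualSemigroup (T n)) (Lp.const 2 (M.meas n) (1 : ℝ)) (h.dualOneAt n) :=
  generator_spec (T := dualSemigroup (T n)) ⟨_, h.one_mem n⟩

end DualUnitCondition

end

theorem lemma2p12 {E : Type*} [MeasurableSpace E] (M : MeasureSequence E) (F : TestSpace M)
    (T : ∀ n, ℝ≥0 → Lp ℝ 2 (M.meas n) →L[ℝ] Lp ℝ 2 (M.meas n))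
    (hT : IsAdmissibleFamily M T) (h : DualUnitCondition F T) :
    (∀ n, ∃ That : ℝ≥0 → Lp ℝ 2 (M.meas n) →L[ℝ] Lp ℝ 2 (M.meas n),
      IsContractionSemigroup That ∧ generator That = h.hatA n ∧
      ∀ (t : ℝ≥0) (g : Lp ℝ 2 (M.meas n)), MemLp g ∞ (M.meas n) →
        eLpNorm (That t g) ∞ (M.meas n) ≤
          ENNReal.ofReal (Real.exp (h.constC * t)) * eLpNorm g ∞ (M.meas n)) ∧
    (∀ α : ℝ, h.constC ≤ α → ∀ n,
      ∃ Tα : ℝ≥0 → Lp ℝ 2 (M.meas n) →L[ℝ] Lp ℝ 2 (M.meas n),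
        IsContractionSemigroup Tα ∧
        generator Tα =
          (generator (T n)).subBounded (α • ContinuousLinearMap.id ℝ (Lp ℝ 2 (M.meas n)))) := by
  refine ⟨fun n => ?_, fun α hα n => ?_⟩
  · exact (hT.isC0Semigroup n).exists_contraction_subBounded_half (hT.hasTransitionFunction n)
      (h.hasGenLimit_dualOneAt n) (h.memLp_top n) h.constC_nonneg (h.ae_abs_dualOneAt_le n)
  · exact (hT.isC0Semigroup n).exists_contraction_subBounded_smul_id
      ((hT.isC0Semigroup n).norm_le_exp (hT.hasTransitionFunction n) (h.hasGenLimit_dualOneAt n)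
        (le_smul_const_of_ae_abs_le (h.ae_abs_dualOneAt_le n))) hα
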